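/- Let $G$ be a group acting by automorphisms on a simplicial tree $X$ (all edges of length $1$), with distance $d_X$, and write $\ell_X(h)=\inf_x d_X(x,hx)$ for translation lengths. Let $g\in G$ be loxodromic and WPD, that is: for some $x\in X$ and every $\varepsilon\ge 0$ there is $N$ such that only finitely many $h\in G$ satisfy $d_X(x,hx)\le\varepsilon$ and $d_X(g^Nx,hg^Nx)\le\varepsilon$. Let $\mathcal Q=\{\mathrm{Axe}(\varphi g\varphi^{-1}) : \varphi\in G\}$ be the set of axes of the conjugates of $g$, and let $\Delta=\sup_{Q_1\ne Q_2\in\mathcal Q}\mathrm{diam}_X(Q_1\cap Q_2)$ (with $\Delta=0$ if $\mathcal Q$ has only one element). Let $n\in\mathbf N$ be such that $\ell_X(g^n)>7\Delta$ and such that the subgroup $G_Q=\langle\varphi g^n\varphi^{-1}\rangle$ attached to $Q=\mathrm{Axe}(\varphi g\varphi^{-1})$ depends only on $Q$; equivalently, if $\mathrm{Axe}(\varphi g\varphi^{-1})=\mathrm{Axe}(g)$, then $\langle \varphi g^n\varphi^{-1}\rangle=\langle g^n\rangle$. The cone-off $\mathring X$ is the graph obtained from $X$ by adding, for each $Q\in\mathcal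 Q$, one new vertex $c_Q$ (an apex), joined by an edge to every vertex of $Q$ (these edges are given a common length $r_0\in(0,\tfrac12)$, which plays no role in what follows). The group $G$ acts on $\mathring X$. Write $\mathring Q$ for the union of $Q$ with all edges to $c_Q$, and $G_c=G_Q$ for $c=c_Q$. For a subgraph $A\subset\mathring X$ let $G_A$ be the subgroup generated by the $G_c$ for all apices $c\in A$, and let $\mathrm{Adj}(A)$ be the set of the apices $c_Q\notin A$ with $Q\cap A\neq\emptyset$ (such a $Q$ is said to be adjacent to $A$). A windmill is a subgraph $W\subset\mathring X$ such that: 1. $W$ and $W\cap X$ are (non-empty and) connected; $W$ is saturated, i.e. equal to the smallest $G_W$-invariant subgraph containing $W$; and $W$ is complete, i.e. for every $Q\in\mathcal Q$, if $c_Q\in W$ or $Q\subset W$, then $\mathring Q\subset W$; 2. $\mathrm{diam}_X(Q\cap W)\le 2\Delta$ for every $Q\in\mathcal Q$ adjacent to $W$; 3. $G_W$ is the internal free product of the groups $G_c$, $c\in S_0$, for some set $S_0$ of apices in $W$; 4. every non-trivial $f\in G_W$ is loxodromic on $X$ with $\ell_X(f)\ge\ell_X(g^n)$, and equality holds if and only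 if $f$ is conjugate in $G$ to $g^n$ or to $g^{-n}$. **Proposition (Growing windmills).** For every windmill $W\subsetneq\mathring X$ there exists a windmill $W'$ strictly containing $W$ and a set $S\subset\mathrm{Adj}(W)$ such that $G_{W'}$ is the internal free product $$G_{W'}=G_W*\Big(\mathop{\ast}_{c\in S}G_c\Big).$$ -/

import Mathlib

/-! Group actions on simplicial trees, cone-offs along axes, and windmills.

A simplicial tree (all edges of length one) is given by its combinatorial tree `X`, and a group
action on it by a homomorphism `ρ : G →* (X ≃g X)` into the automorphism group of `X`. -/

namespace ConeOff

universe u v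

section Isometries

variable {V : Type u} {X : SimpleGraph V}

/-- An automorphism of a simplicial tree is loxodromic if it has no fixed point in the
topological realization. A fixed point is either a vertex, or lies on an edge that is mapped to
itself; if neither end of that edge is fixed, the edge is inverted. -/
def IsLoxodromic (h : X ≃g X) : Prop :=
  (∀ v, h v ≠ v) ∧ ∀ u v, X.Adj u v → ¬ (h u = v ∧ h v = u)

/-- The translation length `inf_v d_X(v, h v)`. For a loxodromic `h` (the only case in which it is
used below) the infimum over the realization is attained along the axis, hence at vertices. -/
noncomputable def translationLength (h : X ≃g X) : ℕ :=
  sInf (Set.range fun v => X.dist v (h v))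

/-- The (vertex set of the) axis of a loxodromic automorphism: the points that realize the
translation length. As a subgraph, an axis is the subgraph of `X` induced on this set. -/
def axis (h : X ≃g X) : Set V := {v | X.dist v (h v) = translationLength h}

/-- Diameter, for the distance of `X`, of a set of vertices of `X`; it is `0` for the empty set. -/
noncomputable def setDiam (X : SimpleGraph V) (S : Set V) : ℕ∞ :=
  ⨆ x ∈ S, ⨆ y ∈ S, X.edist x y

theorem dist_aut (k : X ≃g X) (u v : V) : X.dist (k u) (k v) = X.dist u v := by
  have key : ∀ (k : X ≃g X) (u v : V), X.edist (k u) (k v) ≤ X.edist u v := by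
    intro k u v
    refine le_iInf fun w => ?_
    have := SimpleGraph.edist_le (w.map k.toHom)
    simpa using this
  have h1 := key k u v
  have h2 := key k⁻¹ (k u) (k v)
  simp only [← RelIso.mul_apply, inv_mul_cancel, RelIso.one_apply] at h2
  unfold SimpleGraph.dist
  rw [le_antisymm h1 h2]

theorem translationLength_conj (k h : X ≃g X) :
    translationLength (k * h * k⁻¹) = translationLength h := by
  unfold translationLength
  congr 1
  ext d
  constructor
  · rintro ⟨v, rfl⟩
    refine ⟨k⁻¹ v, ?_⟩
    simp only
    rw [← dist_aut k]
    simp [RelIso.mul_apply, RelIso.apply_inv_self]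
  · rintro ⟨v, rfl⟩
    refine ⟨k v, ?_⟩
    simp [RelIso.mul_apply, RelIso.inv_apply_self, dist_aut]

theorem axis_conj (k h : X ≃g X) : axis (k * h * k⁻¹) = k '' axis h := by
  ext v
  constructor
  · intro hv
    refine ⟨k⁻¹ v, ?_, by simp [RelIso.apply_inv_self]⟩
    have hv' : X.dist v ((k * h * k⁻¹) v) = translationLength (k * h * k⁻¹) := hv
    rw [translationLength_conj] at hv'
    change X.dist (k⁻¹ v) (h (k⁻¹ v)) = translationLength h
    rw [← hv', ← dist_aut k]
    simp [RelIso.mul_apply, RelIso.apply_inv_self]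
  · rintro ⟨w, hw, rfl⟩
    have hw' : X.dist w (h w) = translationLength h := hw
    change X.dist (k w) ((k * h * k⁻¹) (k w)) = translationLength (k * h * k⁻¹)
    rw [translationLength_conj, ← hw']
    simp [RelIso.mul_apply, RelIso.inv_apply_self, dist_aut]

end Isometries

section Action

variable {V : Type u} {X : SimpleGraph V} {G : Type v} [Group G] (ρ : G →* (X ≃g X))

/-- `g` is a WPD element: for some point `x` and every `ε ≥ 0` there is `N` such that only finitely
many elements of `G` move both `x` and `g ^ N x` by at most `ε`. -/
def IsWPD (g : G) : Prop :=
  ∃ x : V, ∀ ε : ℝ, 0 ≤ ε → ∃ N : ℕ,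
    {h : G | (X.dist x (ρ h x) : ℝ) ≤ ε ∧
      (X.dist (ρ (g ^ N) x) (ρ h (ρ (g ^ N) x)) : ℝ) ≤ ε}.Finite

/-- The collection `𝒬` of the axes of all conjugates of `g`. -/
def axes (g : G) : Set (Set V) := {Q | ∃ φ : G, axis (ρ (φ * g * φ⁻¹)) = Q}

/-- `Δ`, the supremum of the diameters of the intersections of two distinct axes in `𝒬`. -/
noncomputable def Delta (g : G) : ℕ∞ :=
  ⨆ Q₁ ∈ axes ρ g, ⨆ Q₂ ∈ axes ρ g, ⨆ _ : Q₁ ≠ Q₂, setDiam X (Q₁ ∩ Q₂)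

/-- The cone-off of `X` relative to `𝒬`: one new vertex (the apex `Sum.inr Q`) for each `Q` in `𝒬`,
joined to all vertices of `Q`. -/
def coneOff (g : G) : SimpleGraph (V ⊕ axes ρ g) where
  Adj
    | Sum.inl u, Sum.inl v => X.Adj u v
    | Sum.inl u, Sum.inr Q => u ∈ Q.1
    | Sum.inr Q, Sum.inl u => u ∈ Q.1
    | Sum.inr _, Sum.inr _ => False
  symm := ⟨by
    rintro (u | Q) (v | R) h
    · exact SimpleGraph.Adj.symm (G := X) h
    · exact h
    · exact h
    · exact h⟩
  loopless := ⟨by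
    rintro (u | Q) h
    · exact X.loopless.irrefl u h
    · exact h⟩

/-- The inclusion of `X` in the cone-off. -/
def inclusion (g : G) : X →g coneOff ρ g where
  toFun := Sum.inl
  map_rel' h := h

theorem image_mem_axes (g h : G) {Q : Set V} (hQ : Q ∈ axes ρ g) : ρ h '' Q ∈ axes ρ g := by
  obtain ⟨φ, rfl⟩ := hQ
  refine ⟨h * φ, ?_⟩
  rw [← axis_conj, ← map_inv, ← map_mul, ← map_mul]
  congr 2
  group

/-- The action of `G` on the vertices of the cone-off. -/
def coneOffFun (g h : G) : V ⊕ axes ρ g → V ⊕ axes ρ g :=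
  Sum.map (ρ h) fun Q => ⟨ρ h '' Q.1, image_mem_axes ρ g h Q.2⟩

theorem coneOffFun_one (g : G) (x : V ⊕ axes ρ g) : coneOffFun ρ g 1 x = x := by
  rcases x with u | Q <;> simp [coneOffFun]

theorem coneOffFun_mul (g h k : G) (x : V ⊕ axes ρ g) :
    coneOffFun ρ g (h * k) x = coneOffFun ρ g h (coneOffFun ρ g k x) := by
  rcases x with u | Q <;> simp [coneOffFun, Set.image_image]

/-- The action of `G` on the cone-off by graph automorphisms. -/
def coneOffAction (g : G) : G →* (coneOff ρ g ≃g coneOff ρ g) where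
  toFun h :=
    { toFun := coneOffFun ρ g h
      invFun := coneOffFun ρ g h⁻¹
      left_inv := fun x => by rw [← coneOffFun_mul, inv_mul_cancel, coneOffFun_one]
      right_inv := fun x => by rw [← coneOffFun_mul, mul_inv_cancel, coneOffFun_one]
      map_rel_iff' := by
        rintro (u | Q) (v | R)
        · exact (ρ h).map_rel_iff
        all_goals simp [coneOffFun, coneOff] }
  map_one' := by
    ext x : 1
    exact coneOffFun_one ρ g x
  map_mul' h k := by
    ext x : 1
    exact coneOffFun_mul ρ g h k x

/-- The part of a subgraph `A` of the cone-off that lies in `X`. -/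
def treePart {g : G} (A : (coneOff ρ g).Subgraph) : X.Subgraph := A.comap (inclusion ρ g)

/-- The cone over `Q`: the union of `Q` with all edges to its apex. -/
def cone {g : G} (Q : axes ρ g) : (coneOff ρ g).Subgraph :=
  (⊤ : (coneOff ρ g).Subgraph).induce (insert (Sum.inr Q) (Sum.inl '' Q.1))

/-- `Adj(A)`: the apices that are not in `A` and whose geodesic meets `A`. -/
def adjacentApices {g : G} (A : (coneOff ρ g).Subgraph) : Set (axes ρ g) :=
  {Q | (Q.1 ∩ (treePart ρ A).verts).Nonempty ∧ Sum.inr Q ∉ A.verts}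

/-- The apices in `A`. -/
def apicesIn {g : G} (A : (coneOff ρ g).Subgraph) : Set (axes ρ g) := {Q | Sum.inr Q ∈ A.verts}

/-- `G_c` for the apex `c` of `Q`: the subgroup generated by `φ g ^ n φ⁻¹`, where `Q` is the axis of
`φ g φ⁻¹`. All admissible `φ` are used at once; in the theorem all of them give the same cyclic
subgroup. -/
def apexGroup {g : G} (n : ℕ) (Q : axes ρ g) : Subgroup G :=
  Subgroup.closure {f | ∃ φ : G, axis (ρ (φ * g * φ⁻¹)) = Q.1 ∧ f = φ * g ^ n * φ⁻¹}

/-- `G_A`: the subgroup generated by all `G_c`, where `c` runs over the apices in `A`. -/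
def groupOf {g : G} (n : ℕ) (A : (coneOff ρ g).Subgraph) : Subgroup G :=
  ⨆ Q ∈ apicesIn ρ A, apexGroup ρ n Q

/-- A subgraph `B` of the cone-off is invariant under a subgroup `H` of `G`. -/
def IsInvariant {g : G} (H : Subgroup G) (B : (coneOff ρ g).Subgraph) : Prop :=
  ∀ h ∈ H, B.map (coneOffAction ρ g h).toHom = B

/-- The saturate of `A`: the smallest `G_A`-invariant subgraph that contains `A`. -/
def saturate {g : G} (n : ℕ) (A : (coneOff ρ g).Subgraph) : (coneOff ρ g).Subgraph :=
  sInf {B | A ≤ B ∧ IsInvariant ρ (groupOf ρ n A) B}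

/-- `A` is saturated if it equals its saturate. -/
def IsSaturated {g : G} (n : ℕ) (A : (coneOff ρ g).Subgraph) : Prop := A = saturate ρ n A

/-- `A` is complete if it contains the cone over `Q` as soon as it contains the apex of `Q` or the
geodesic `Q` (with its edges). -/
def IsComplete {g : G} (A : (coneOff ρ g).Subgraph) : Prop :=
  ∀ Q : axes ρ g,
    (Sum.inr Q ∈ A.verts ∨ (⊤ : X.Subgraph).induce Q.1 ≤ treePart ρ A) → cone ρ Q ≤ A

/-- `A` is quasiconvex if `A` and its part in `X` are both connected. -/
def IsQuasiconvex {g : G} (A : (coneOff ρ g).Subgraph) : Prop :=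
  A.Connected ∧ (treePart ρ A).Connected

/-- The subgroup `H` is the (internal) free product of the subgroups `G_c`, `c ∈ S`. -/
def IsFreeProductOfApexGroups {g : G} (n : ℕ) (S : Set (axes ρ g)) (H : Subgroup G) : Prop :=
  Function.Injective
    (Monoid.CoprodI.lift fun c : S => (apexGroup ρ n c.1).subtype) ∧
  (Monoid.CoprodI.lift fun c : S => (apexGroup ρ n c.1).subtype).range = H

/-- The subgroup `H'` is the (internal) free product of `H` and of the subgroups `G_c`, `c ∈ S`. -/
def IsFreeProductWithApexGroups {g : G} (n : ℕ) (H : Subgroup G) (S : Set (axes ρ g))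
    (H' : Subgroup G) : Prop :=
  Function.Injective
    (Monoid.Coprod.lift H.subtype
      (Monoid.CoprodI.lift fun c : S => (apexGroup ρ n c.1).subtype)) ∧
  (Monoid.Coprod.lift H.subtype
      (Monoid.CoprodI.lift fun c : S => (apexGroup ρ n c.1).subtype)).range = H'

/-- Windmills. -/
structure IsWindmill {g : G} (n : ℕ) (W : (coneOff ρ g).Subgraph) : Prop where
  quasiconvex : IsQuasiconvex ρ W
  saturated : IsSaturated ρ n W
  complete : IsComplete ρ W
  /-- An adjacent geodesic meets `W` in a set of diameter at most `2Δ`. -/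
  diam_adjacent : ∀ Q ∈ adjacentApices ρ W,
    setDiam X (Q.1 ∩ (treePart ρ W).verts) ≤ 2 * Delta ρ g
  /-- `G_W` is a free product of some of the groups `G_c`, where `c` is an apex in `W`. -/
  free_product : ∃ S ⊆ apicesIn ρ W, IsFreeProductOfApexGroups ρ n S (groupOf ρ n W)
  /-- Nontrivial elements of `G_W` are loxodromic, of translation length at least that of `g ^ n`,
  with equality exactly for the conjugates in `G` of `g ^ n` and of its inverse. -/
  loxodromic : ∀ f ∈ groupOf ρ n W, f ≠ 1 →
    IsLoxodromic (ρ f) ∧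
    translationLength (ρ (g ^ n)) ≤ translationLength (ρ f) ∧
    (translationLength (ρ f) = translationLength (ρ (g ^ n)) ↔
      IsConj f (g ^ n) ∨ IsConj f (g ^ n)⁻¹)

end Action

end ConeOff

/-! Put K = G_W and L = ℓ(g^n) > 7Δ; let C be the vertex set of W ∩ X, a convex set, and 𝒜 the set
of axes adjacent to W. An axis of 𝒜 meets C in diameter at most 2Δ, while nontrivial elements of K
move every point by at least L, so K acts freely on 𝒜. Let S be a transversal of its orbits. In the
abstract free product of K and the G_c, c ∈ S, the K-conjugates of the factors G_c are indexed by 𝒜.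
Up to conjugation, an element lies in K, lies in one of these conjugates, or is a cyclically reduced
word b_0 ⋯ b_{m-1} w with w ∈ K (`exists_isConj_cyclicallyReduced`).

Such a word determines a chain of axes Z_j = b_0 ⋯ b_{j-1} Q_j, which its image in G shifts by m.
The projections of two neighbouring axes to Q_j have diameter at most Δ and meet Q_j ∩ C; twisting
one of them by b_j ≠ 1 puts them at distance at least L - 4Δ > 0 (`Hub.le_dist_gates`). In a tree
this local condition makes geodesics follow the chain (`chain_dist_le`), and every displacement
exceeds L (`Hub.lt_dist_of_cyclicallyReduced`). So every nontrivial element of the free product has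
an image as required by condition 4 (`Hub.isLong`); in particular the map to G is injective.

If 𝒜 is nonempty, W' is spanned by the translates of C, of the axes in 𝒜 and of the corresponding
apices under the group P generated by K and the G_Q, Q ∈ 𝒜. An axis R outside W' avoids all
translates of C. Two translated axes that R meets are joined by a reduced chain; if its length is at
least 2, then R overlaps an intermediate axis too much, and otherwise the overlap of R with W' is at
most 2Δ (`Hub.dist_le_of_mem_spread`). If 𝒜 is empty, W' is obtained by thickening C by one edge,
with the same group. -/

namespace ConeOff

universe u v

/-! ### Metric geometry of trees: medians, the four-point condition, gates, convexity. -/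

section Tree

variable {V : Type u} {X : SimpleGraph V}

/-- The vertex `m` lies on the geodesic from `a` to `b`. -/
def Between (X : SimpleGraph V) (a m b : V) : Prop := X.dist a m + X.dist m b = X.dist a b

/-- A set of vertices is convex if it contains the geodesics between its points. -/
def IsConvex (X : SimpleGraph V) (C : Set V) : Prop :=
  ∀ a ∈ C, ∀ b ∈ C, ∀ m, Between X a m b → m ∈ C

/-- `p` is the gate (nearest point projection) of `x` in `C`. -/
def IsGate (X : SimpleGraph V) (C : Set V) (x p : V) : Prop :=
  p ∈ C ∧ ∀ c ∈ C, X.dist x c = X.dist x p + X.dist p c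

theorem exists_adj_dist_succ (hX : X.Connected) {x y : V} (h : x ≠ y) :
    ∃ z, X.Adj y z ∧ X.dist x z + 1 = X.dist x y := by
  obtain ⟨p, hp⟩ := hX.exists_walk_length_eq_dist y x
  cases p with
  | nil => exact absurd rfl h
  | @cons _ z _ hadj q =>
    refine ⟨z, hadj, ?_⟩
    have h1 := X.dist_le q
    have h2 := hX.dist_triangle (u := x) (v := z) (w := y)
    rw [SimpleGraph.Walk.length_cons] at hp
    rw [X.dist_comm (u := z) (v := y), SimpleGraph.dist_eq_one_iff_adj.2 hadj] at h2
    rw [X.dist_comm (u := y) (v := x)] at hp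
    rw [X.dist_comm (u := z) (v := x)] at h1
    omega

/-- Both neighbours begin a geodesic from `y` to `z`, and paths in a tree are unique. -/
theorem pred_unique (hX : X.IsTree) {z y u v : V} (hu : X.Adj y u) (hv : X.Adj y v)
    (hzu : X.dist z u + 1 = X.dist z y) (hzv : X.dist z v + 1 = X.dist z y) : u = v := by
  obtain ⟨p, hp⟩ := hX.1.exists_walk_length_eq_dist u z
  obtain ⟨q, hq⟩ := hX.1.exists_walk_length_eq_dist v z
  have hp' : (SimpleGraph.Walk.cons hu p).IsPath := by
    apply SimpleGraph.Walk.isPath_of_length_eq_dist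
    rw [SimpleGraph.Walk.length_cons, hp, X.dist_comm (u := u), hzu, X.dist_comm]
  have hq' : (SimpleGraph.Walk.cons hv q).IsPath := by
    apply SimpleGraph.Walk.isPath_of_length_eq_dist
    rw [SimpleGraph.Walk.length_cons, hq, X.dist_comm (u := v), hzv, X.dist_comm]
  have := (hX.2.subsingleton_path y z).elim ⟨_, hp'⟩ ⟨_, hq'⟩
  have := congrArg Subtype.val this
  have := congrArg SimpleGraph.Walk.snd this
  simpa using this

/-- The median for the predecessor `y'` of `y` still serves `y`, unless `y` is closer to `z` than
`y'`. In that case the old median has to be `y'` and the new one is `y`. -/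
theorem exists_median (hX : X.IsTree) (x y z : V) :
    ∃ m, Between X x m y ∧ Between X x m z ∧ Between X y m z := by
  induction hn : X.dist x y generalizing y with
  | zero =>
    obtain rfl := hX.1.dist_eq_zero_iff.1 hn
    exact ⟨x, by simp [Between], by simp [Between], by simp [Between]⟩
  | succ n ih =>
    have hne : x ≠ y := by rintro rfl; simp at hn
    obtain ⟨y', hadj, hy'⟩ := exists_adj_dist_succ hX.1 hne
    obtain ⟨m, h1, h2, h3⟩ := ih y' (by omega)
    have hyy' : X.dist y y' = 1 := SimpleGraph.dist_eq_one_iff_adj.2 hadj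
    have t1 := hX.1.dist_triangle (u := x) (v := m) (w := y)
    have t2 := hX.1.dist_triangle (u := y) (v := y') (w := m)
    have c1 := X.dist_comm (u := m) (v := y)
    have c2 := X.dist_comm (u := m) (v := y')
    have c3 := X.dist_comm (u := z) (v := y')
    have c4 := X.dist_comm (u := z) (v := y)
    have c5 := X.dist_comm (u := z) (v := m)
    unfold Between at h1 h2 h3
    rcases hX.dist_eq_dist_add_one_of_adj z hadj with h | h
    · exact ⟨m, by unfold Between; omega, h2, by unfold Between; omega⟩
    · by_cases hm : m = y'
      · subst hm
        refine ⟨y, by simp [Between], ?_, by simp [Between]⟩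
        unfold Between
        omega
      · exfalso
        obtain ⟨y'', hadj', hy''⟩ := exists_adj_dist_succ hX.1 hm
        have c6 := X.dist_comm (u := m) (v := y'')
        have t3 := hX.1.dist_triangle (u := z) (v := m) (w := y'')
        have t4 := hX.1.dist_triangle (u := x) (v := m) (w := y'')
        have e1 := hX.dist_eq_dist_add_one_of_adj z hadj'
        have e2 := hX.dist_eq_dist_add_one_of_adj x hadj'
        have : y'' = y := pred_unique hX (z := z) hadj' hadj.symm (by omega) (by omega)
        subst this
        omega

theorem exists_between_dist (hX : X.Connected) {x y : V} {k : ℕ} (hk : k ≤ X.dist x y) :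
    ∃ m, Between X x m y ∧ X.dist x m = k := by
  induction hn : X.dist x y - k generalizing k with
  | zero => exact ⟨y, by simp [Between], by omega⟩
  | succ n ih =>
    obtain ⟨m, hm, hmk⟩ := ih (k := k + 1) (by omega) (by omega)
    have hne : x ≠ m := by rintro rfl; simp at hmk
    obtain ⟨z, hz, hxz⟩ := exists_adj_dist_succ hX hne
    refine ⟨z, ?_, by omega⟩
    have t1 := hX.dist_triangle (u := x) (v := z) (w := y)
    have t2 := hX.dist_triangle (u := z) (v := m) (w := y)
    rw [SimpleGraph.dist_eq_one_iff_adj.2 hz.symm] at t2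
    unfold Between at *
    omega

theorem between_unique (hX : X.IsTree) {x y m k : V} (hm : Between X x m y)
    (hk : Between X x k y) (h : X.dist x m = X.dist x k) : m = k := by
  induction hn : X.dist x m generalizing m k with
  | zero => exact (hX.1.dist_eq_zero_iff.1 hn).symm.trans (hX.1.dist_eq_zero_iff.1 (h.symm.trans hn))
  | succ n ih =>
    have hne : x ≠ m := by rintro rfl; simp at hn
    have hne' : x ≠ k := by rintro rfl; rw [SimpleGraph.dist_self] at h; omega
    obtain ⟨m', hm', hxm⟩ := exists_adj_dist_succ hX.1 hne
    obtain ⟨k', hk', hxk⟩ := exists_adj_dist_succ hX.1 hne'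
    have t1 := hX.1.dist_triangle (u := x) (v := m') (w := y)
    have t2 := hX.1.dist_triangle (u := m') (v := m) (w := y)
    have t3 := hX.1.dist_triangle (u := x) (v := k') (w := y)
    have t4 := hX.1.dist_triangle (u := k') (v := k) (w := y)
    rw [SimpleGraph.dist_eq_one_iff_adj.2 hm'.symm] at t2
    rw [SimpleGraph.dist_eq_one_iff_adj.2 hk'.symm] at t4
    unfold Between at *
    obtain rfl := ih (m := m') (k := k') (by omega) (by omega) (by omega) (by omega)
    apply pred_unique hX (z := y) hm'.symm hk'.symm <;>
      rw [X.dist_comm (u := y), X.dist_comm (u := y)] <;> omega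

theorem between_of_dist_le (hX : X.IsTree) {x y m k : V} (hm : Between X x m y)
    (hk : Between X x k y) (h : X.dist x m ≤ X.dist x k) : Between X x m k := by
  obtain ⟨l, hl, hlm⟩ := exists_between_dist hX.1 h
  have t1 := hX.1.dist_triangle (u := x) (v := l) (w := y)
  have t2 := hX.1.dist_triangle (u := l) (v := k) (w := y)
  have : l = m := between_unique hX (y := y) (by unfold Between at *; omega) hm hlm
  exact this ▸ hl

/-- Trees are `0`-hyperbolic. -/
theorem four_point (hX : X.IsTree) (x y z w : V) :
    X.dist x y + X.dist z w ≤
      max (X.dist x z + X.dist y w) (X.dist x w + X.dist y z) := by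
  obtain ⟨m, a1, a2, a3⟩ := exists_median hX x y z
  obtain ⟨k, b1, b2, b3⟩ := exists_median hX x y w
  have t1 := hX.1.dist_triangle (u := z) (v := m) (w := w)
  have t2 := hX.1.dist_triangle (u := m) (v := k) (w := w)
  have key : X.dist x m + X.dist k y + X.dist m k = X.dist x y ∨
      X.dist x k + X.dist m y + X.dist m k = X.dist x y := by
    rcases le_total (X.dist x m) (X.dist x k) with h | h
    · have := between_of_dist_le hX a1 b1 h
      unfold Between at *
      omega
    · have := between_of_dist_le hX b1 a1 h
      have := X.dist_comm (u := k) (v := m)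
      unfold Between at *
      omega
  have e1 := X.dist_comm (u := z) (v := m)
  have e2 := X.dist_comm (u := w) (v := k)
  have e3 := X.dist_comm (u := y) (v := m)
  have e4 := X.dist_comm (u := y) (v := k)
  have e5 := X.dist_comm (u := w) (v := m)
  have e6 := X.dist_comm (u := k) (v := m)
  unfold Between at *
  rcases key with h | h <;> omega

theorem Between.symm {a m b : V} (h : Between X a m b) : Between X b m a := by
  have := X.dist_comm (u := b) (v := m)
  have := X.dist_comm (u := m) (v := a)
  have := X.dist_comm (u := b) (v := a)
  unfold Between at *
  omega

/-- Two sides of a tripod cover the third one. -/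
theorem Between.or (hX : X.IsTree) {a m b : V} (h : Between X a m b) (c : V) :
    Between X a m c ∨ Between X c m b := by
  have f := four_point hX a b c m
  have t1 := hX.1.dist_triangle (u := a) (v := m) (w := c)
  have t2 := hX.1.dist_triangle (u := c) (v := m) (w := b)
  have := X.dist_comm (u := c) (v := m)
  have := X.dist_comm (u := b) (v := m)
  have := X.dist_comm (u := b) (v := c)
  unfold Between at *
  omega

theorem IsConvex.exists_gate (hX : X.IsTree) {C : Set V} (hC : IsConvex X C)
    (hne : C.Nonempty) (x : V) : ∃ p, IsGate X C x p := by
  obtain ⟨p, hp, hmin⟩ := WellFounded.has_min (measure (X.dist x)).wf C hne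
  refine ⟨p, hp, fun c hc => ?_⟩
  by_contra hcon
  have hpc : p ≠ c := by rintro rfl; simp at hcon
  have hpos := hX.1.pos_dist_of_ne hpc
  obtain ⟨m, hm, hpm⟩ := exists_between_dist hX.1 (x := p) (y := c) (k := 1) hpos
  have hmC := hC p hp c hc m hm
  have hmin' : X.dist x p ≤ X.dist x m := not_lt.1 (hmin m hmC)
  have hadj : X.Adj p m := SimpleGraph.dist_eq_one_iff_adj.1 hpm
  have e := hX.dist_eq_dist_add_one_of_adj x hadj
  have f := four_point hX x m p c
  have t := hX.1.dist_triangle (u := x) (v := p) (w := c)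
  have := X.dist_comm (u := m) (v := p)
  unfold Between at hm
  omega

/-- Distinct gates force the geodesic from `x` to `y` through both, by the four-point condition. The
local-to-global arguments rest on this. -/
theorem IsGate.dist_eq_of_ne (hX : X.IsTree) {C : Set V} {x y p q : V} (hp : IsGate X C x p)
    (hq : IsGate X C y q) (h : p ≠ q) :
    X.dist x y = X.dist x p + X.dist p q + X.dist q y := by
  have hpos := hX.1.pos_dist_of_ne h
  have f := four_point hX x q y p
  have h1 := hp.2 q hq.1
  have h2 := hq.2 p hp.1
  have t1 := hX.1.dist_triangle (u := x) (v := p) (w := y)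
  have t2 := hX.1.dist_triangle (u := p) (v := q) (w := y)
  have := X.dist_comm (u := y) (v := q)
  have := X.dist_comm (u := y) (v := p)
  have := X.dist_comm (u := p) (v := q)
  omega

theorem IsGate.dist_le (hX : X.IsTree) {C : Set V} {x y p q : V} (hp : IsGate X C x p)
    (hq : IsGate X C y q) : X.dist p q ≤ X.dist x y := by
  by_cases h : p = q
  · simp [h]
  · rw [hp.dist_eq_of_ne hX hq h]
    omega

theorem IsGate.between {C : Set V} {x p c : V} (hp : IsGate X C x p) (hc : c ∈ C) :
    Between X x p c := (hp.2 c hc).symm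

theorem IsGate.unique (hX : X.IsTree) {C : Set V} {x p q : V} (hp : IsGate X C x p)
    (hq : IsGate X C x q) : p = q := by
  have h1 := hp.2 q hq.1
  have h2 := hq.2 p hp.1
  have := X.dist_comm (u := p) (v := q)
  exact hX.1.dist_eq_zero_iff.1 (by omega)

/-- The gate in `C` of a point of a convex set that meets `C` lies in the intersection. -/
theorem IsGate.mem_of_inter {C Q : Set V} (hQ : IsConvex X Q) {x p c : V}
    (hp : IsGate X C x p) (hx : x ∈ Q) (hc : c ∈ C) (hcQ : c ∈ Q) : p ∈ Q :=
  hQ x hx c hcQ p (hp.between hc)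

theorem IsGate.between_of_ne (hX : X.IsTree) {C : Set V} {x y p q : V} (hp : IsGate X C x p)
    (hq : IsGate X C y q) (h : p ≠ q) : Between X x p y ∧ Between X x q y := by
  have h0 := hp.dist_eq_of_ne hX hq h
  have h1 := hX.1.dist_triangle (u := x) (v := p) (w := y)
  have h2 := hX.1.dist_triangle (u := p) (v := q) (w := y)
  have h3 := hX.1.dist_triangle (u := x) (v := p) (w := q)
  have h4 := hX.1.dist_triangle (u := x) (v := q) (w := y)
  unfold Between
  omega

theorem IsGate.of_between {C : Set V} {x p z : V} (hX : X.IsTree) (hp : IsGate X C x p)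
    (hz : Between X x z p) : IsGate X C z p := by
  refine ⟨hp.1, fun c hc => ?_⟩
  have h1 := hp.2 c hc
  have h2 := hX.1.dist_triangle (u := x) (v := z) (w := c)
  have h3 := hX.1.dist_triangle (u := z) (v := p) (w := c)
  unfold Between at hz
  omega

theorem IsConvex.induce_connected (hX : X.Connected) {C : Set V} (hC : IsConvex X C)
    (hne : C.Nonempty) : ((⊤ : X.Subgraph).induce C).Connected := by
  rw [SimpleGraph.Subgraph.connected_iff]
  refine ⟨?_, hne⟩
  rw [SimpleGraph.Subgraph.preconnected_iff]
  rintro ⟨a, ha⟩ ⟨b, hb⟩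
  induction hn : X.dist a b generalizing b with
  | zero =>
    obtain rfl := hX.dist_eq_zero_iff.1 hn
    exact SimpleGraph.Reachable.refl _
  | succ n ih =>
    have hne : a ≠ b := by rintro rfl; simp at hn
    obtain ⟨z, hadj, hz⟩ := exists_adj_dist_succ hX hne
    have hzC : z ∈ C := hC a ha b hb z (by
      unfold Between
      rw [SimpleGraph.dist_eq_one_iff_adj.2 hadj.symm, hz])
    refine (ih z hzC (by omega)).trans (SimpleGraph.Adj.reachable ?_)
    simpa [hzC, show b ∈ C from hb] using hadj.symm

/-- A walk inside `H` shortens to a path, which is the only path between its ends. -/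
theorem toSubgraph_le_of_connected (hX : X.IsTree) {H : X.Subgraph}
    (hH : H.Connected) {a b : V} (ha : a ∈ H.verts) (hb : b ∈ H.verts) (p : X.Walk a b)
    (hp : p.IsPath) : p.toSubgraph ≤ H := by
  classical
  obtain ⟨q, hq⟩ := ((SimpleGraph.Subgraph.connected_iff_forall_exists_walk_subgraph H).1 hH).2
    ha hb
  have h1 := (hX.2.subsingleton_path a b).elim ⟨p, hp⟩ ⟨q.bypass, q.bypass_isPath⟩
  have h2 : p = q.bypass := congrArg Subtype.val h1
  rw [h2]
  exact q.toSubgraph_bypass_le_toSubgraph.trans hq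

theorem isConvex_verts_of_connected (hX : X.IsTree) {H : X.Subgraph} (hH : H.Connected) :
    IsConvex X H.verts := by
  intro a ha b hb m hm
  obtain ⟨p, hp⟩ := hX.1.exists_walk_length_eq_dist a m
  obtain ⟨q, hq⟩ := hX.1.exists_walk_length_eq_dist m b
  have hpath : (p.append q).IsPath := by
    apply SimpleGraph.Walk.isPath_of_length_eq_dist
    rw [SimpleGraph.Walk.length_append, hp, hq]
    exact hm
  apply (toSubgraph_le_of_connected hX hH ha hb _ hpath).1
  rw [SimpleGraph.Walk.mem_verts_toSubgraph, SimpleGraph.Walk.mem_support_append_iff]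
  exact Or.inl p.end_mem_support

theorem adj_of_connected (hX : X.IsTree) {H : X.Subgraph} (hH : H.Connected) {a b : V}
    (ha : a ∈ H.verts) (hb : b ∈ H.verts) (hab : X.Adj a b) : H.Adj a b := by
  have hpath : hab.toWalk.IsPath := by
    apply SimpleGraph.Walk.isPath_of_length_eq_dist
    rw [SimpleGraph.dist_eq_one_iff_adj.2 hab]
    rfl
  exact (toSubgraph_le_of_connected hX hH ha hb _ hpath).2 (by simp)

end Tree
-- Displacement, axes and powers of tree automorphisms.
section Automorphisms

variable {V : Type u} {X : SimpleGraph V}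

theorem Between.map {a m b : V} (h : Between X a m b) (k : X ≃g X) :
    Between X (k a) (k m) (k b) := by
  unfold Between
  simp only [dist_aut]
  exact h

theorem IsConvex.image {C : Set V} (hC : IsConvex X C) (k : X ≃g X) : IsConvex X (k '' C) := by
  rintro _ ⟨a, ha, rfl⟩ _ ⟨b, hb, rfl⟩ m hm
  refine ⟨k⁻¹ m, hC a ha b hb _ ?_, RelIso.apply_inv_self k m⟩
  have := hm.map k⁻¹
  rwa [RelIso.inv_apply_self, RelIso.inv_apply_self] at this

theorem IsGate.image {C : Set V} {x p : V} (h : IsGate X C x p) (k : X ≃g X) :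
    IsGate X (k '' C) (k x) (k p) := by
  refine ⟨⟨p, h.1, rfl⟩, ?_⟩
  rintro _ ⟨c, hc, rfl⟩
  simp only [dist_aut]
  exact h.2 c hc

theorem translationLength_le (h : X ≃g X) (v : V) : translationLength h ≤ X.dist v (h v) :=
  Nat.sInf_le ⟨v, rfl⟩

theorem le_translationLength [Nonempty V] {h : X ≃g X} {c : ℕ} (hc : ∀ v, c ≤ X.dist v (h v)) :
    c ≤ translationLength h := by
  obtain ⟨v, hv⟩ := Nat.sInf_mem (Set.range_nonempty fun v => X.dist v (h v))
  exact (hc v).trans hv.le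

theorem axis_nonempty [Nonempty V] (h : X ≃g X) : (axis h).Nonempty :=
  Nat.sInf_mem (Set.range_nonempty fun v => X.dist v (h v))

/-- Here `m` lies between `p` and one of the two ends. -/
theorem Between.dist_le_max (hX : X.IsTree) {a m b : V} (h : Between X a m b) (p : V) :
    X.dist m p + X.dist a m ≤ X.dist a p ∨ X.dist m p + X.dist m b ≤ X.dist b p := by
  have f := four_point hX a b m p
  unfold Between at h
  have := X.dist_comm (u := b) (v := m)
  omega

/-- Displacement is convex along geodesics of a tree, so the set where it is minimal is convex. -/
theorem isConvex_axis (hX : X.IsTree) (h : X ≃g X) : IsConvex X (axis h) := by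
  intro a ha b hb m hm
  refine le_antisymm ?_ (translationLength_le h m)
  change X.dist a (h a) = _ at ha
  change X.dist b (h b) = _ at hb
  have hm' := hm.map h
  have e1 := hm.dist_le_max hX (h m)
  have e2 := hm'.dist_le_max hX a
  have e3 := hm'.dist_le_max hX b
  have d1 := dist_aut h a b
  have d2 := dist_aut h a m
  have d3 := dist_aut h m b
  have t1 := hX.1.dist_triangle (u := a) (v := h a) (w := h b)
  have t2 := hX.1.dist_triangle (u := b) (v := h b) (w := h a)
  have c1 := X.dist_comm (u := h m) (v := a)
  have c2 := X.dist_comm (u := h m) (v := b)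
  have c3 := X.dist_comm (u := h a) (v := a)
  have c4 := X.dist_comm (u := h b) (v := a)
  have c5 := X.dist_comm (u := h b) (v := b)
  have c6 := X.dist_comm (u := h a) (v := b)
  have c7 := X.dist_comm (u := h a) (v := h b)
  unfold Between at hm hm'
  omega

theorem dist_pow_le (hX : X.Connected) (f : X ≃g X) (v : V) (k : ℕ) :
    X.dist v ((f ^ k) v) ≤ k * X.dist v (f v) := by
  induction k with
  | zero => simp
  | succ k ih =>
    have t := hX.dist_triangle (u := v) (v := (f ^ k) v) (w := (f ^ (k + 1)) v)
    rw [pow_succ, RelIso.mul_apply, dist_aut] at t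
    rw [pow_succ, RelIso.mul_apply]
    linarith

/-- Linear growth of an orbit bounds all displacements from below. -/
theorem le_dist_of_growth (hX : X.Connected) (f : X ≃g X) (p q : V) (c K : ℕ)
    (h : ∀ k : ℕ, k * c ≤ X.dist p ((f ^ k) q) + K) (v : V) : c ≤ X.dist v (f v) := by
  by_contra hcon
  push Not at hcon
  set e := X.dist v (f v) with he
  have key : ∀ k : ℕ, k ≤ X.dist p v + X.dist v q + K := by
    intro k
    have h1 := h k
    have t1 := hX.dist_triangle (u := p) (v := v) (w := (f ^ k) q)
    have t2 := hX.dist_triangle (u := v) (v := (f ^ k) v) (w := (f ^ k) q)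
    rw [dist_aut] at t2
    have t3 := dist_pow_le hX f v k
    have h2 : k * (e + 1) ≤ k * c := Nat.mul_le_mul_left k hcon
    rw [← he] at t3
    linarith
  have := key (X.dist p v + X.dist v q + K + 1)
  omega

theorem IsLoxodromic.pos_dist (hX : X.Connected) {h : X ≃g X} (hl : IsLoxodromic h) (v : V) :
    0 < X.dist v (h v) := hX.pos_dist_of_ne (hl.1 v).symm

theorem IsLoxodromic.translationLength_pos (hX : X.Connected) {h : X ≃g X}
    (hl : IsLoxodromic h) : 0 < translationLength h :=
  have := hX.nonempty
  le_translationLength fun v => hl.pos_dist hX v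

/-- Suppose the orbit path turned back at `h x`, and let `z` follow `x` on the geodesic to `h x`.
Then `h z` lies on that geodesic too, so `z` is displaced by two less than `x`; if the translation
length is one, the edge from `x` to `z` is inverted instead. -/
theorem IsLoxodromic.between_axis (hX : X.IsTree) {h : X ≃g X} (hl : IsLoxodromic h) {x : V}
    (hx : x ∈ axis h) : Between X x (h x) (h (h x)) := by
  by_contra hcon
  change X.dist x (h x) = translationLength h at hx
  have hpos := hl.translationLength_pos hX.1
  have hd := dist_aut h x (h x)
  obtain ⟨m, m1, m2, m3⟩ := exists_median hX x (h x) (h (h x))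
  have hm : m ≠ h x := by rintro rfl; exact hcon m2
  obtain ⟨y, hy, hmy⟩ := exists_adj_dist_succ hX.1 hm
  have hne : h x ≠ x := hl.1 x
  obtain ⟨z, hz, hxz⟩ := exists_adj_dist_succ hX.1 hne
  have hz' : X.Adj (h x) (h z) := h.map_rel_iff.2 hz
  have hzd := dist_aut h (h x) z
  have hzd' := dist_aut h (h x) x
  have c1 := X.dist_comm (u := h x) (v := x)
  have e1 := hX.dist_eq_dist_add_one_of_adj x hy
  have e2 := hX.dist_eq_dist_add_one_of_adj (h (h x)) hy
  have c2 := X.dist_comm (u := h (h x)) (v := y)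
  have c3 := X.dist_comm (u := h (h x)) (v := h x)
  have c4 := X.dist_comm (u := m) (v := h x)
  have t1 := hX.1.dist_triangle (u := x) (v := m) (w := y)
  have t2 := hX.1.dist_triangle (u := y) (v := m) (w := h (h x))
  have c5 := X.dist_comm (u := m) (v := y)
  unfold Between at m1 m2 m3
  obtain rfl : y = h z :=
    pred_unique hX (z := h (h x)) hy hz' (by omega) (by omega)
  have a1 := SimpleGraph.dist_eq_one_iff_adj.2 hz
  have a2 := SimpleGraph.dist_eq_one_iff_adj.2 hy
  have c6 := X.dist_comm (u := h x) (v := z)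
  have c7 := X.dist_comm (u := h x) (v := h z)
  by_cases h1 : translationLength h = 1
  · have : x = h z := hX.1.dist_eq_zero_iff.1 (by omega)
    have : h x = z := hX.1.dist_eq_zero_iff.1 (by omega)
    refine hl.2 x z hz ⟨by assumption, by symm; assumption⟩
  · have b : Between X x z (h z) :=
      between_of_dist_le hX (y := h x) (by unfold Between; omega) (by unfold Between; omega)
        (by omega)
    have := translationLength_le h z
    unfold Between at b
    omega

theorem apply_mem_axis {h : X ≃g X} {x : V} (hx : x ∈ axis h) : h x ∈ axis h := by
  change X.dist (h x) (h (h x)) = _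
  rw [dist_aut]
  exact hx

theorem pow_apply_mem_axis {h : X ≃g X} {x : V} (hx : x ∈ axis h) (k : ℕ) :
    (h ^ k) x ∈ axis h := by
  induction k with
  | zero => exact hx
  | succ k ih =>
    rw [pow_succ', RelIso.mul_apply]
    exact apply_mem_axis ih

theorem IsLoxodromic.dist_pow (hX : X.IsTree) {h : X ≃g X} (hl : IsLoxodromic h) {x : V}
    (hx : x ∈ axis h) (k : ℕ) : X.dist x ((h ^ k) x) = k * translationLength h := by
  have key : X.dist x ((h ^ k) x) = k * translationLength h ∧
      X.dist x ((h ^ (k + 1)) x) = (k + 1) * translationLength h := by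
    induction k with
    | zero =>
      refine ⟨by simp, ?_⟩
      rw [zero_add, pow_one, one_mul]
      exact hx
    | succ k ih =>
      refine ⟨by exact_mod_cast ih.2, ?_⟩
      have hk := pow_apply_mem_axis hx k
      have b := hl.between_axis hX hk
      have b1 : X.dist ((h ^ k) x) (h ((h ^ k) x)) = translationLength h := hk
      have b2 : X.dist (h ((h ^ k) x)) (h (h ((h ^ k) x))) = translationLength h :=
        apply_mem_axis hk
      rw [pow_succ', RelIso.mul_apply] at ih
      rw [pow_succ', RelIso.mul_apply, pow_succ', RelIso.mul_apply]
      set y := (h ^ k) x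
      have f := four_point hX x (h y) y (h (h y))
      have t := hX.1.dist_triangle (u := x) (v := h y) (w := h (h y))
      have c := X.dist_comm (u := h y) (v := y)
      have hpos := hl.translationLength_pos hX.1
      unfold Between at b
      have e1 : (k + 1) * translationLength h = k * translationLength h + translationLength h := by
        ring
      have e2 : (k + 1 + 1) * translationLength h =
        k * translationLength h + translationLength h + translationLength h := by ring
      omega
  exact key.1

theorem IsLoxodromic.le_dist_pow (hX : X.IsTree) {h : X ≃g X} (hl : IsLoxodromic h) (k : ℕ)
    (v : V) : k * translationLength h ≤ X.dist v ((h ^ k) v) := by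
  have := hX.1.nonempty
  obtain ⟨x, hx⟩ := axis_nonempty h
  refine le_dist_of_growth hX.1 (h ^ k) x x _ 0 (fun j => ?_) v
  rw [← pow_mul, hl.dist_pow hX hx]
  exact le_of_eq (by ring)

theorem IsLoxodromic.translationLength_pow (hX : X.IsTree) {h : X ≃g X} (hl : IsLoxodromic h)
    (k : ℕ) : translationLength (h ^ k) = k * translationLength h := by
  have := hX.1.nonempty
  obtain ⟨x, hx⟩ := axis_nonempty h
  refine le_antisymm ?_ (le_translationLength fun v => hl.le_dist_pow hX k v)
  rw [← hl.dist_pow hX hx]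
  exact translationLength_le _ x

theorem IsLoxodromic.of_two_le {h : X ≃g X} (h2 : ∀ v, 2 ≤ X.dist v (h v)) :
    IsLoxodromic h := by
  refine ⟨fun v hv => ?_, fun u v huv hinv => ?_⟩
  · have := h2 v
    rw [hv, SimpleGraph.dist_self] at this
    omega
  · have := h2 u
    rw [hinv.1, SimpleGraph.dist_eq_one_iff_adj.2 huv] at this
    omega

theorem IsLoxodromic.pow (hX : X.IsTree) {h : X ≃g X} (hl : IsLoxodromic h) {k : ℕ}
    (hk : k ≠ 0) : IsLoxodromic (h ^ k) := by
  have hpos := hl.translationLength_pos hX.1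
  have key : ∀ j : ℕ, j ≠ 0 → ∀ v, (h ^ j) v ≠ v := by
    intro j hj v hv
    have := hl.le_dist_pow hX j v
    rw [hv, SimpleGraph.dist_self] at this
    have := Nat.mul_pos (Nat.pos_of_ne_zero hj) hpos
    omega
  -- If `h ^ k` inverted an edge, `h ^ (k + k)` would fix a vertex.
  refine ⟨key k hk, fun u v huv hinv => key (k + k) (by omega) u ?_⟩
  rw [pow_add, RelIso.mul_apply, hinv.1, hinv.2]

theorem translationLength_inv (h : X ≃g X) : translationLength h⁻¹ = translationLength h := by
  unfold translationLength
  congr 1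
  ext d
  constructor
  · rintro ⟨v, rfl⟩
    refine ⟨h⁻¹ v, ?_⟩
    simp only [RelIso.apply_inv_self]
    exact X.dist_comm
  · rintro ⟨v, rfl⟩
    refine ⟨h v, ?_⟩
    simp only [RelIso.inv_apply_self]
    exact X.dist_comm

theorem IsLoxodromic.inv {h : X ≃g X} (hl : IsLoxodromic h) : IsLoxodromic h⁻¹ := by
  refine ⟨fun v hv => hl.1 v ?_, fun u v huv hinv => hl.2 v u huv.symm ?_⟩
  · conv_lhs => rw [← hv, RelIso.apply_inv_self]
  · rw [← hinv.1, RelIso.apply_inv_self]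
    refine ⟨rfl, ?_⟩
    conv_lhs => rw [← hinv.2, RelIso.apply_inv_self]
    exact hinv.1.symm

theorem IsLoxodromic.conj {h : X ≃g X} (hl : IsLoxodromic h) (k : X ≃g X) :
    IsLoxodromic (k * h * k⁻¹) := by
  refine ⟨fun v hv => hl.1 (k⁻¹ v) ?_, fun u v huv hinv => hl.2 (k⁻¹ u) (k⁻¹ v) ?_ ?_⟩
  · rw [RelIso.mul_apply, RelIso.mul_apply] at hv
    conv_rhs => rw [← hv, RelIso.inv_apply_self]
  · exact k⁻¹.map_rel_iff.2 huv
  · simp only [RelIso.mul_apply] at hinv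
    constructor
    · rw [← hinv.1, RelIso.inv_apply_self]
    · conv_rhs => rw [← hinv.2, RelIso.inv_apply_self]

end Automorphisms

/-! ### Apex groups and the small cancellation assumptions. -/

section Apices

variable {V : Type u} {X : SimpleGraph V} {G : Type v} [Group G] (ρ : G →* (X ≃g X))

theorem axis_map_conj (h a : G) : axis (ρ (h * a * h⁻¹)) = ρ h '' axis (ρ a) := by
  rw [map_mul, map_mul, map_inv, axis_conj]

/-- The action of `G` on the collection of axes. -/
def axesPerm (g : G) : G →* Equiv.Perm (axes ρ g) where
  toFun h :=
    { toFun := fun Q => ⟨ρ h '' Q.1, image_mem_axes ρ g h Q.2⟩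
      invFun := fun Q => ⟨ρ h⁻¹ '' Q.1, image_mem_axes ρ g h⁻¹ Q.2⟩
      left_inv := fun Q => by
        ext v
        simp [Set.image_image]
      right_inv := fun Q => by
        ext v
        simp [Set.image_image] }
  map_one' := by
    ext Q v
    simp
  map_mul' h k := by
    ext Q v
    simp [Set.image_image]

theorem coe_axesPerm (g h : G) (Q : axes ρ g) : (axesPerm ρ g h Q).1 = ρ h '' Q.1 := rfl

theorem apply_mem_axesPerm {g h : G} {Q : axes ρ g} {v : V} :
    ρ h v ∈ (axesPerm ρ g h Q).1 ↔ v ∈ Q.1 :=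
  (ρ h).injective.mem_set_image

theorem inv_apply_apply (h : G) (v : V) : ρ h⁻¹ (ρ h v) = v := by
  rw [← RelIso.mul_apply, ← map_mul, inv_mul_cancel, map_one, RelIso.one_apply]

/-- The standing assumptions of the construction, with `D` the bound `Δ` for the overlaps. -/
structure SmallCancellation (g : G) (n D : ℕ) : Prop where
  tree : X.IsTree
  lox : IsLoxodromic (ρ g)
  lt_length : 7 * D < translationLength (ρ (g ^ n))
  overlap : ∀ Q R : axes ρ g, Q ≠ R → ∀ x ∈ Q.1, ∀ y ∈ Q.1, x ∈ R.1 → y ∈ R.1 → X.dist x y ≤ D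
  zpowers_eq : ∀ φ : G, axis (ρ (φ * g * φ⁻¹)) = axis (ρ g) →
    Subgroup.zpowers (φ * g ^ n * φ⁻¹) = Subgroup.zpowers (g ^ n)

variable {ρ}

theorem isConvex_of_mem_axes (hX : X.IsTree) {g : G} (Q : axes ρ g) : IsConvex X Q.1 := by
  obtain ⟨Q, φ, rfl⟩ := Q
  exact isConvex_axis hX _

theorem nonempty_of_mem_axes (hX : X.IsTree) {g : G} (Q : axes ρ g) : Q.1.Nonempty := by
  have := hX.1.nonempty
  obtain ⟨Q, φ, rfl⟩ := Q
  exact axis_nonempty _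

theorem apexGroup_conj {g : G} {n : ℕ} {Q : axes ρ g} {f : G} (h : G)
    (hf : f ∈ apexGroup ρ n Q) : h * f * h⁻¹ ∈ apexGroup ρ n (axesPerm ρ g h Q) := by
  have : apexGroup ρ n Q ≤ (apexGroup ρ n (axesPerm ρ g h Q)).comap (MulAut.conj h).toMonoidHom := by
    unfold apexGroup
    rw [Subgroup.closure_le]
    rintro _ ⟨φ, hφ, rfl⟩
    refine Subgroup.subset_closure ⟨h * φ, ?_, ?_⟩
    · rw [coe_axesPerm, ← hφ, ← axis_map_conj]
      congr 2
      group
    · simp only [MulEquiv.coe_toMonoidHom, MulAut.conj_apply]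
      group
  exact this hf

namespace SmallCancellation

variable {g : G} {n D : ℕ} (hs : SmallCancellation ρ g n D)

include hs

/-- The assumption `zpowers_eq` speaks only of the axis of `g`; conjugation by `φ` carries it to
`Q`. -/
theorem apexGroup_eq {Q : axes ρ g} {φ : G} (hφ : axis (ρ (φ * g * φ⁻¹)) = Q.1) :
    apexGroup ρ n Q = Subgroup.zpowers (φ * g ^ n * φ⁻¹) := by
  apply le_antisymm
  · unfold apexGroup
    rw [Subgroup.closure_le]
    rintro _ ⟨ψ, hψ, rfl⟩
    have h1 : axis (ρ (φ⁻¹ * ψ * g * (φ⁻¹ * ψ)⁻¹)) = axis (ρ g) := by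
      have e : φ⁻¹ * ψ * g * (φ⁻¹ * ψ)⁻¹ = φ⁻¹ * (ψ * g * ψ⁻¹) * φ⁻¹⁻¹ := by group
      rw [e, axis_map_conj, hψ, ← hφ, ← axis_map_conj]
      congr 2
      group
    have h2 : φ⁻¹ * ψ * g ^ n * (φ⁻¹ * ψ)⁻¹ ∈ Subgroup.zpowers (g ^ n) := by
      rw [← hs.zpowers_eq _ h1]
      exact Subgroup.mem_zpowers _
    obtain ⟨k, hk⟩ := Subgroup.mem_zpowers_iff.1 h2
    refine Subgroup.mem_zpowers_iff.2 ⟨k, ?_⟩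
    rw [conj_zpow, hk]
    group
  · rw [Subgroup.zpowers_le]
    exact Subgroup.subset_closure ⟨φ, hφ, rfl⟩

theorem exists_eq_conj_zpow {Q : axes ρ g} {f : G} (hf : f ∈ apexGroup ρ n Q) :
    ∃ (φ : G) (k : ℤ), axis (ρ (φ * g * φ⁻¹)) = Q.1 ∧ f = φ * (g ^ n) ^ k * φ⁻¹ := by
  obtain ⟨φ, hφ⟩ := Q.2
  rw [hs.apexGroup_eq hφ] at hf
  obtain ⟨k, rfl⟩ := Subgroup.mem_zpowers_iff.1 hf
  exact ⟨φ, k, hφ, conj_zpow⟩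

theorem axesPerm_eq_self {Q : axes ρ g} {f : G} (hf : f ∈ apexGroup ρ n Q) :
    axesPerm ρ g f Q = Q := by
  obtain ⟨φ, k, hφ, rfl⟩ := hs.exists_eq_conj_zpow hf
  ext1
  rw [coe_axesPerm, ← hφ, ← axis_map_conj]
  congr 2
  rw [← zpow_natCast, ← zpow_mul]
  have : g * g ^ (n * k : ℤ) = g ^ (n * k : ℤ) * g := (Commute.refl g).zpow_right _
  group

theorem ne_zero : n ≠ 0 := by
  rintro rfl
  have h1 := hs.lt_length
  have := hs.tree.1.nonempty
  have h2 := translationLength_le (ρ (g ^ 0)) (Classical.arbitrary V)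
  simp at h1 h2
  omega

theorem exists_pow_eq {f : G} {Q : axes ρ g} (hf : f ∈ apexGroup ρ n Q) (h1 : f ≠ 1) :
    ∃ (φ : G) (k : ℕ), k ≠ 0 ∧
      (f = φ * (g ^ n) ^ k * φ⁻¹ ∨ f = (φ * (g ^ n) ^ k * φ⁻¹)⁻¹) := by
  obtain ⟨φ, k, -, rfl⟩ := hs.exists_eq_conj_zpow hf
  have hk : k ≠ 0 := by rintro rfl; simp at h1
  refine ⟨φ, k.natAbs, by omega, ?_⟩
  rcases Int.natAbs_eq k with h | h
  · left
    conv_lhs => rw [h]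
    rw [zpow_natCast]
  · right
    conv_lhs => rw [h]
    rw [zpow_neg, zpow_natCast]
    group

theorem lox_pow : IsLoxodromic (ρ (g ^ n)) := by
  rw [map_pow]
  exact hs.lox.pow hs.tree hs.ne_zero

/-- Nontrivial elements of the apex groups are loxodromic of length at least that of `g ^ n`. -/
theorem apexGroup_loxodromic {f : G} {Q : axes ρ g} (hf : f ∈ apexGroup ρ n Q) (h1 : f ≠ 1) :
    IsLoxodromic (ρ f) ∧
    translationLength (ρ (g ^ n)) ≤ translationLength (ρ f) ∧
    (translationLength (ρ f) = translationLength (ρ (g ^ n)) ↔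
      IsConj f (g ^ n) ∨ IsConj f (g ^ n)⁻¹) := by
  obtain ⟨φ, k, hk, h⟩ := hs.exists_pow_eq hf h1
  have hpos := hs.lox_pow.translationLength_pos hs.tree.1
  have hlox : IsLoxodromic (ρ (φ * (g ^ n) ^ k * φ⁻¹)) := by
    rw [map_mul, map_mul, map_inv, map_pow]
    exact (hs.lox_pow.pow hs.tree hk).conj _
  have hlen : translationLength (ρ (φ * (g ^ n) ^ k * φ⁻¹)) =
      k * translationLength (ρ (g ^ n)) := by
    rw [map_mul, map_mul, map_inv, translationLength_conj, map_pow ρ (g ^ n),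
      hs.lox_pow.translationLength_pow hs.tree]
  have hconj : ∀ a b : G, IsConj a b → translationLength (ρ a) = translationLength (ρ b) := by
    intro a b hab
    obtain ⟨c, rfl⟩ := isConj_iff.1 hab
    rw [map_mul, map_mul, map_inv, translationLength_conj]
  have hlen' : translationLength (ρ f) = k * translationLength (ρ (g ^ n)) := by
    rcases h with rfl | rfl
    · exact hlen
    · rw [map_inv, translationLength_inv, hlen]
  refine ⟨?_, ?_, ⟨fun he => ?_, ?_⟩⟩
  · rcases h with rfl | rfl
    · exact hlox
    · rw [map_inv]
      exact hlox.inv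
  · rw [hlen']
    exact Nat.le_mul_of_pos_left _ (Nat.pos_of_ne_zero hk)
  · rw [hlen'] at he
    have : k = 1 := Nat.eq_of_mul_eq_mul_right hpos (by rw [he, one_mul])
    subst this
    rw [pow_one] at h
    rcases h with rfl | rfl
    · exact Or.inl (isConj_iff.2 ⟨φ⁻¹, by group⟩)
    · exact Or.inr (isConj_iff.2 ⟨φ⁻¹, by group⟩)
  · rintro (h | h)
    · exact hconj _ _ h
    · rw [hconj _ _ h, map_inv, translationLength_inv]

theorem apexGroup_le_dist {f : G} {Q : axes ρ g} (hf : f ∈ apexGroup ρ n Q) (h1 : f ≠ 1)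
    (v : V) : translationLength (ρ (g ^ n)) ≤ X.dist v (ρ f v) :=
  (hs.apexGroup_loxodromic hf h1).2.1.trans (translationLength_le _ v)

end SmallCancellation

end Apices

/-! ### Local-to-global principle for chains of convex sets. -/

section Chain

variable {V : Type u} {X : SimpleGraph V}

/-- Local-to-global principle for a chain of convex sets in a tree. If, for each member of the
chain, the projections of its two neighbours are at positive distance, then geodesics from the first
to the last member follow the chain. -/
theorem chain_dist_le (hX : X.IsTree) (Z : ℕ → Set V) (hZ : ∀ j, IsConvex X (Z j))
    (hne : ∀ j, (Z j).Nonempty) (B : ℕ) (γ : ℕ → ℕ) (hB : 0 < B)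
    (hγ : ∀ j, ∀ x ∈ Z j, ∀ y ∈ Z (j + 1), γ j ≤ X.dist x y) (M : ℕ)
    (hβ : ∀ j < M, ∀ x ∈ Z j, ∀ y ∈ Z (j + 2), ∀ p q, IsGate X (Z (j + 1)) x p →
      IsGate X (Z (j + 1)) y q → B ≤ X.dist p q) {x : V} (hx : x ∈ Z 0) :
    (∀ z ∈ Z (M + 1), ∑ j ∈ Finset.range M, (γ j + B) + γ M ≤ X.dist x z) ∧
    (∀ p, IsGate X (Z (M + 1)) x p → ∃ y ∈ Z M, IsGate X (Z (M + 1)) y p) := by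
  induction M with
  | zero => exact ⟨fun z hz => by simpa using hγ 0 x hx z hz, fun p hp => ⟨x, hx, hp⟩⟩
  | succ M ih =>
    obtain ⟨ih1, ih2⟩ := ih fun j hj => hβ j (by omega)
    -- The gate `y` of `x` is by induction also the gate of a point `t` of `Z M`, so the local
    -- hypothesis at `Z (M + 1)` applies to `x` through `t`.
    obtain ⟨y, hy⟩ := (hZ (M + 1)).exists_gate hX (hne _) x
    obtain ⟨t, ht, hty⟩ := ih2 y hy
    have key : ∀ z ∈ Z (M + 1 + 1), ∀ z', IsGate X (Z (M + 1)) z z' →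
        B ≤ X.dist y z' ∧ y ≠ z' := by
      intro z hz z' hz'
      have h := hβ M (by omega) t ht z hz y z' hty hz'
      exact ⟨h, by rintro rfl; rw [SimpleGraph.dist_self] at h; omega⟩
    constructor
    · intro z hz
      obtain ⟨z', hz'⟩ := (hZ (M + 1)).exists_gate hX (hne _) z
      have h1 := key z hz z' hz'
      have h2 := hy.dist_eq_of_ne hX hz' h1.2
      have h3 := ih1 y hy.1
      have h4 := hγ (M + 1) z' hz'.1 z hz
      rw [Finset.sum_range_succ]
      omega
    · intro p hp
      obtain ⟨z', hz'⟩ := (hZ (M + 1)).exists_gate hX (hne _) p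
      have h1 := key p hp.1 z' hz'
      exact ⟨z', hz'.1, hp.of_between hX (hy.between_of_ne hX hz' h1.2).2⟩

end Chain

/-! ### Displacement estimates around an invariant convex set. -/

section Hub

variable {V : Type u} {X : SimpleGraph V} {G : Type v} [Group G] {ρ : G →* (X ≃g X)}

theorem isGate_axesPerm {g h : G} {Q : axes ρ g} {x p : V} :
    IsGate X (axesPerm ρ g h Q).1 (ρ h x) (ρ h p) ↔ IsGate X Q.1 x p := by
  refine ⟨fun H => ?_, fun H => H.image (ρ h)⟩
  have := H.image (ρ h⁻¹)
  rw [inv_apply_apply, inv_apply_apply, ← coe_axesPerm, ← Equiv.Perm.mul_apply, ← map_mul,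
    inv_mul_cancel, map_one, Equiv.Perm.one_apply] at this
  exact this

/-- If the gates differ, the geodesic from `x` to `y`, which stays in `R`, passes through both, so
both lie in the overlap of `R` and `Q`. -/
theorem SmallCancellation.gate_dist_le {g : G} {n D : ℕ} (hs : SmallCancellation ρ g n D)
    {Q R : axes ρ g} (h : R ≠ Q) {x y p q : V} (hx : x ∈ R.1) (hy : y ∈ R.1)
    (hp : IsGate X Q.1 x p) (hq : IsGate X Q.1 y q) : X.dist p q ≤ D := by
  by_cases hpq : p = q
  · simp [hpq]
  · have hb := hp.between_of_ne hs.tree hq hpq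
    have hc := isConvex_of_mem_axes hs.tree R
    exact hs.overlap R Q h p (hc x hx y hy p hb.1) q (hc x hx y hy q hb.2) hp.1 hq.1

/-- A convex set `C`, invariant under a group `K` with loxodromic elements, together with an
invariant family of axes that have small overlap with `C`. -/
structure Hub (ρ : G →* (X ≃g X)) (g : G) (n D : ℕ) (C : Set V) (K : Subgroup G)
    (𝒜 : Set (axes ρ g)) : Prop where
  sc : SmallCancellation ρ g n D
  convex : IsConvex X C
  apply_mem : ∀ k ∈ K, ∀ v ∈ C, ρ k v ∈ C
  perm_mem : ∀ k ∈ K, ∀ Q ∈ 𝒜, axesPerm ρ g k Q ∈ 𝒜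
  meets : ∀ Q ∈ 𝒜, (Q.1 ∩ C).Nonempty
  diam_le : ∀ Q ∈ 𝒜, ∀ x ∈ Q.1, ∀ y ∈ Q.1, x ∈ C → y ∈ C → X.dist x y ≤ 2 * D
  loxodromic : ∀ f ∈ K, f ≠ 1 →
    IsLoxodromic (ρ f) ∧
    translationLength (ρ (g ^ n)) ≤ translationLength (ρ f) ∧
    (translationLength (ρ f) = translationLength (ρ (g ^ n)) ↔
      IsConj f (g ^ n) ∨ IsConj f (g ^ n)⁻¹)

namespace Hub

variable {g : G} {n D : ℕ} {C : Set V} {K : Subgroup G} {𝒜 : Set (axes ρ g)}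
  (hH : Hub ρ g n D C K 𝒜)

include hH

theorem le_dist {k : G} (hk : k ∈ K) (h1 : k ≠ 1) (v : V) :
    translationLength (ρ (g ^ n)) ≤ X.dist v (ρ k v) :=
  (hH.loxodromic k hk h1).2.1.trans (translationLength_le _ v)

/-- A nontrivial `k` preserving `Q` would move a point of `Q ∩ C` within `Q ∩ C` by more than `7 *
D`, but the diameter is at most `2 * D`. -/
theorem eq_one_of_perm_eq {k : G} (hk : k ∈ K) {Q : axes ρ g} (hQ : Q ∈ 𝒜)
    (h : axesPerm ρ g k Q = Q) : k = 1 := by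
  by_contra h1
  obtain ⟨x, hxQ, hxC⟩ := hH.meets Q hQ
  have h2 : ρ k x ∈ Q.1 := by
    rw [← h, apply_mem_axesPerm]
    exact hxQ
  have h3 := hH.diam_le Q hQ x hxQ _ h2 hxC (hH.apply_mem k hk x hxC)
  have h4 := hH.le_dist hk h1 x
  have h5 := hH.sc.lt_length
  omega

theorem exists_gate_mem {Q R : axes ρ g} (hQ : Q ∈ 𝒜) (hR : R ∈ 𝒜) :
    ∃ r ∈ R.1, ∃ a ∈ C, IsGate X Q.1 r a := by
  obtain ⟨r, hrR, hrC⟩ := hH.meets R hR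
  obtain ⟨c, hcQ, hcC⟩ := hH.meets Q hQ
  obtain ⟨a, ha⟩ := (isConvex_of_mem_axes hH.sc.tree Q).exists_gate hH.sc.tree ⟨c, hcQ⟩ r
  exact ⟨r, hrR, a, ha.mem_of_inter hH.convex hrC hcQ hcC, ha⟩

/-- The loss is D + 2D + D: the projections of `R` and `R'` to `Q` have diameter at most D, and each
contains a point of `Q ∩ C`, whose diameter is at most 2D. -/
theorem le_dist_gates {Q R R' : axes ρ g} (hQ : Q ∈ 𝒜) (hR : R ∈ 𝒜) (hR' : R' ∈ 𝒜)
    (h : R ≠ Q) (h' : R' ≠ Q) {b : G} (hb : b ∈ apexGroup ρ n Q) (hb1 : b ≠ 1) {x y p q : V}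
    (hx : x ∈ R.1) (hy : y ∈ R'.1) (hp : IsGate X Q.1 x p) (hq : IsGate X Q.1 y q) :
    translationLength (ρ (g ^ n)) ≤ X.dist p (ρ b q) + 4 * D := by
  obtain ⟨r, hr, a, haC, ha⟩ := hH.exists_gate_mem hQ hR
  obtain ⟨s, hs, c, hcC, hc⟩ := hH.exists_gate_mem hQ hR'
  have h1 := hH.sc.gate_dist_le h hr hx ha hp
  have h2 := hH.sc.gate_dist_le h' hs hy hc hq
  have h3 := hH.diam_le Q hQ c hc.1 a ha.1 hcC haC
  have h4 := hH.sc.apexGroup_le_dist hb hb1 c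
  have t1 := hH.sc.tree.1.dist_triangle (u := c) (v := a) (w := ρ b c)
  have t2 := hH.sc.tree.1.dist_triangle (u := a) (v := p) (w := ρ b c)
  have t3 := hH.sc.tree.1.dist_triangle (u := p) (v := ρ b q) (w := ρ b c)
  rw [dist_aut, X.dist_comm (u := q)] at t3
  omega

/-- With a single neighbour `R`, both gates lie in one projection, so only D is lost. -/
theorem le_dist_gates_self {Q R : axes ρ g}
    (h : R ≠ Q) {b : G} (hb : b ∈ apexGroup ρ n Q) (hb1 : b ≠ 1) {x y p q : V}
    (hx : x ∈ R.1) (hy : y ∈ R.1) (hp : IsGate X Q.1 x p) (hq : IsGate X Q.1 y q) :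
    translationLength (ρ (g ^ n)) ≤ X.dist p (ρ b q) + D := by
  have h1 := hH.sc.gate_dist_le h hy hx hq hp
  have h4 := hH.sc.apexGroup_le_dist hb hb1 q
  have t1 := hH.sc.tree.1.dist_triangle (u := q) (v := p) (w := ρ b q)
  omega

/-- Projection to `C` does not increase distances and keeps points of an axis meeting `C` on that
axis. So the distance between two axes is attained inside `C`. -/
theorem exists_dist_le {Q R : axes ρ g} (hQ : Q ∈ 𝒜) (hR : R ∈ 𝒜) {p q : V} (hp : p ∈ Q.1)
    (hq : q ∈ R.1) : ∃ p' ∈ Q.1, ∃ q' ∈ R.1, p' ∈ C ∧ q' ∈ C ∧ X.dist p' q' ≤ X.dist p q := by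
  obtain ⟨r, hrR, hrC⟩ := hH.meets R hR
  obtain ⟨c, hcQ, hcC⟩ := hH.meets Q hQ
  obtain ⟨p', hp'⟩ := hH.convex.exists_gate hH.sc.tree ⟨r, hrC⟩ p
  obtain ⟨q', hq'⟩ := hH.convex.exists_gate hH.sc.tree ⟨r, hrC⟩ q
  exact ⟨p', hp'.mem_of_inter (isConvex_of_mem_axes hH.sc.tree Q) hp hcC hcQ, q',
    hq'.mem_of_inter (isConvex_of_mem_axes hH.sc.tree R) hq hrC hrR, hp'.1, hq'.1,
    hp'.dist_le hH.sc.tree hq'⟩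

end Hub

/-- The product of the first `j` letters of a sequence. -/
def prodUpTo {E : Type*} [Group E] (b : ℕ → E) (j : ℕ) : E := ((List.range j).map b).prod

section ProdUpTo

variable {E : Type*} [Group E] (b : ℕ → E)

@[simp] theorem prodUpTo_zero : prodUpTo b 0 = 1 := rfl

theorem prodUpTo_succ (j : ℕ) : prodUpTo b (j + 1) = prodUpTo b j * b j :=
  List.prod_range_succ b j

theorem prodUpTo_succ' (j : ℕ) : prodUpTo b (j + 1) = b 0 * prodUpTo (fun i => b (i + 1)) j :=
  List.prod_range_succ' b j

/-- This is why `prodUpTo b m * w` shifts the chain of axes by `m`. -/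
theorem prodUpTo_add_mul {m : ℕ} {w : E} (h : ∀ j, b (j + m) = w * b j * w⁻¹) (j : ℕ) :
    prodUpTo b (j + m) * w = prodUpTo b m * w * prodUpTo b j := by
  induction j with
  | zero => simp
  | succ j ih =>
    rw [add_right_comm, prodUpTo_succ, h, prodUpTo_succ, ← mul_assoc _ _ (b j), ← ih]
    group

theorem prodUpTo_congr {b c : ℕ → E} {j : ℕ} (h : ∀ i < j, b i = c i) :
    prodUpTo b j = prodUpTo c j := by
  unfold prodUpTo
  rw [List.map_congr_left fun i hi => h i (List.mem_range.1 hi)]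

theorem map_prodUpTo {F : Type*} [Group F] (φ : E →* F) (j : ℕ) :
    φ (prodUpTo b j) = prodUpTo (fun i => φ (b i)) j := by
  unfold prodUpTo
  rw [map_list_prod, List.map_map]
  rfl

end ProdUpTo

/-- The chain of axes determined by a sequence of axes and a sequence of group elements. -/
def axisChain {g : G} (q : ℕ → axes ρ g) (b : ℕ → G) (j : ℕ) : axes ρ g :=
  axesPerm ρ g (prodUpTo b j) (q j)

namespace Hub

variable {g : G} {n D : ℕ} {C : Set V} {K : Subgroup G} {𝒜 : Set (axes ρ g)}
  (hH : Hub ρ g n D C K 𝒜)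

include hH

/-- As `b j` preserves `q j`, consecutive members of the chain are translates of `q j` and `q (j +
1)` by one common element. The translating elements on the two sides of member `j + 1` differ by the
letter `b (j + 1)`. -/
theorem axisChain_gates {q : ℕ → axes ρ g} {b : ℕ → G}
    (hb : ∀ j, b j ∈ apexGroup ρ n (q j)) {B j : ℕ}
    (hB : ∀ x ∈ (q j).1, ∀ y ∈ (q (j + 2)).1, ∀ p r, IsGate X (q (j + 1)).1 x p →
      IsGate X (q (j + 1)).1 y r → B ≤ X.dist p (ρ (b (j + 1)) r))
    {x y p r : V} (hx : x ∈ (axisChain q b j).1) (hy : y ∈ (axisChain q b (j + 2)).1)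
    (hp : IsGate X (axisChain q b (j + 1)).1 x p) (hr : IsGate X (axisChain q b (j + 1)).1 y r) :
    B ≤ X.dist p r := by
  have e0 : axisChain q b j = axesPerm ρ g (prodUpTo b (j + 1)) (q j) := by
    rw [prodUpTo_succ, map_mul, Equiv.Perm.mul_apply, hH.sc.axesPerm_eq_self (hb j)]
    rfl
  have e1 : axisChain q b (j + 1) = axesPerm ρ g (prodUpTo b (j + 2)) (q (j + 1)) := by
    rw [prodUpTo_succ, map_mul, Equiv.Perm.mul_apply, hH.sc.axesPerm_eq_self (hb (j + 1))]
    rfl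
  set u := prodUpTo b (j + 1) with hu
  set u' := prodUpTo b (j + 2) with hu'
  have huu : u' = u * b (j + 1) := prodUpTo_succ _ _
  obtain ⟨x, rfl⟩ := (ρ u).surjective x
  obtain ⟨p, rfl⟩ := (ρ u).surjective p
  obtain ⟨y, rfl⟩ := (ρ u').surjective y
  obtain ⟨r, rfl⟩ := (ρ u').surjective r
  rw [e0, apply_mem_axesPerm] at hx
  rw [axisChain, ← hu', apply_mem_axesPerm] at hy
  rw [axisChain, ← hu, isGate_axesPerm] at hp
  rw [e1, isGate_axesPerm] at hr
  have := hB x hx y hy p r hp hr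
  rwa [huu, map_mul, RelIso.mul_apply, dist_aut]

theorem axisChain_dist {q : ℕ → axes ρ g} {b : ℕ → G}
    (hb : ∀ j, b j ∈ apexGroup ρ n (q j)) {γ : ℕ → ℕ}
    (hγ : ∀ j, ∀ x ∈ (q j).1, ∀ y ∈ (q (j + 1)).1, γ j ≤ X.dist x y) (j : ℕ) {x y : V}
    (hx : x ∈ (axisChain q b j).1) (hy : y ∈ (axisChain q b (j + 1)).1) : γ j ≤ X.dist x y := by
  have e0 : axisChain q b j = axesPerm ρ g (prodUpTo b (j + 1)) (q j) := by
    rw [prodUpTo_succ, map_mul, Equiv.Perm.mul_apply, hH.sc.axesPerm_eq_self (hb j)]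
    rfl
  set u := prodUpTo b (j + 1) with hu
  obtain ⟨x, rfl⟩ := (ρ u).surjective x
  obtain ⟨y, rfl⟩ := (ρ u).surjective y
  rw [e0, apply_mem_axesPerm] at hx
  rw [axisChain, ← hu, apply_mem_axesPerm] at hy
  rw [dist_aut]
  exact hγ j x hx y hy

/-- Displacement bound for an element given by a periodic chain. -/
theorem le_dist_of_periodic {q : ℕ → axes ρ g} {b : ℕ → G}
    (hb : ∀ j, b j ∈ apexGroup ρ n (q j)) {m : ℕ} {w : G}
    (hqw : ∀ j, q (j + m) = axesPerm ρ g w (q j)) (hbw : ∀ j, b (j + m) = w * b j * w⁻¹)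
    {γ : ℕ → ℕ} {B c : ℕ} (hB0 : 0 < B)
    (hγ : ∀ j, ∀ x ∈ (q j).1, ∀ y ∈ (q (j + 1)).1, γ j ≤ X.dist x y)
    (hB : ∀ j, ∀ x ∈ (q j).1, ∀ y ∈ (q (j + 2)).1, ∀ p r, IsGate X (q (j + 1)).1 x p →
      IsGate X (q (j + 1)).1 y r → B ≤ X.dist p (ρ (b (j + 1)) r))
    (hc : ∀ k, k * c ≤ ∑ j ∈ Finset.range (m * k), (γ j + B)) (v : V) :
    c ≤ X.dist v (ρ (prodUpTo b m * w) v) := by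
  set f := prodUpTo b m * w with hf
  have hstep : ∀ j, axisChain q b (j + m) = axesPerm ρ g f (axisChain q b j) := by
    intro j
    rw [axisChain, hqw, ← Equiv.Perm.mul_apply, ← map_mul, prodUpTo_add_mul b hbw, map_mul]
    rfl
  -- The offset by one matches `chain_dist_le`, which measures from member 0 to member `M + 1`, with
  -- `M = m * k`.
  have hsteps : ∀ k, axisChain q b (m * k + 1) = axesPerm ρ g (f ^ k) (axisChain q b 1) := by
    intro k
    induction k with
    | zero => simp
    | succ k ih =>
      rw [mul_add, mul_one, add_right_comm, hstep, ih, ← Equiv.Perm.mul_apply, ← map_mul, pow_succ']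
  obtain ⟨x, hx⟩ := nonempty_of_mem_axes hH.sc.tree (axisChain q b 0)
  obtain ⟨y, hy⟩ := nonempty_of_mem_axes hH.sc.tree (axisChain q b 1)
  refine le_dist_of_growth hH.sc.tree.1 (ρ f) x y c 0 (fun k => ?_) v
  have h := (chain_dist_le hH.sc.tree (fun j => (axisChain q b j).1)
    (fun j => isConvex_of_mem_axes hH.sc.tree _) (fun j => nonempty_of_mem_axes hH.sc.tree _)
    B γ hB0 (fun j x hx y hy => hH.axisChain_dist hb hγ j hx hy) (m * k)
    (fun j _ x hx y hy p r hp hr => hH.axisChain_gates hb (hB j) hx hy hp hr) hx).1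
    (ρ (f ^ k) y) (by rw [hsteps, apply_mem_axesPerm]; exact hy)
  rw [map_pow] at h
  have := hc k
  omega

/-- The elements given by cyclically reduced words move all points by more than the length of
`g ^ n`. -/
theorem lt_dist_of_cyclicallyReduced {q : ℕ → axes ρ g} {b : ℕ → G}
    (hq : ∀ j, q j ∈ 𝒜) (hne : ∀ j, q j ≠ q (j + 1))
    (hb : ∀ j, b j ∈ apexGroup ρ n (q j)) (hb1 : ∀ j, b j ≠ 1) {m : ℕ} (hm : m ≠ 0) {w : G}
    (hw : w ∈ K)
    (hqw : ∀ j, q (j + m) = axesPerm ρ g w (q j)) (hbw : ∀ j, b (j + m) = w * b j * w⁻¹) (v : V) :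
    translationLength (ρ (g ^ n)) + 1 ≤ X.dist v (ρ (prodUpTo b m * w) v) := by
  set L := translationLength (ρ (g ^ n)) with hL
  have hlt := hH.sc.lt_length
  rw [← hL] at hlt
  have hB4 : ∀ j, ∀ x ∈ (q j).1, ∀ y ∈ (q (j + 2)).1, ∀ p r, IsGate X (q (j + 1)).1 x p →
      IsGate X (q (j + 1)).1 y r → L - 4 * D ≤ X.dist p (ρ (b (j + 1)) r) := by
    intro j x hx y hy p r hp hr
    have := hH.le_dist_gates (hq _) (hq j) (hq (j + 2)) (hne j) (hne (j + 1)).symm (hb (j + 1))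
      (hb1 _) hx hy hp hr
    omega
  -- A period contributes at least m(L - 4D), which exceeds L when m ≥ 3. For m = 2 this would
  -- require L > 8D, so short periods need a further gain.
  rcases (show m = 1 ∨ m = 2 ∨ 3 ≤ m by omega) with rfl | rfl | hm3
  -- Now `q (j + 1)` is the translate of `q j` by `w ≠ 1`, so consecutive axes are L - 2D apart and
  -- a period yields 2L - 6D > L.
  · have hw1 : w ≠ 1 := by
      rintro rfl
      have := hqw 0
      rw [map_one, Equiv.Perm.one_apply] at this
      exact hne 0 this.symm
    refine hH.le_dist_of_periodic hb hqw hbw (γ := fun _ => L - 2 * D) (B := L - 4 * D) (by omega)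
      (fun j x hx y hy => ?_) hB4 (fun k => ?_) v
    · obtain ⟨x', hx', y', hy', hxC, hyC, hle⟩ := hH.exists_dist_le (hq j) (hq (j + 1)) hx hy
      rw [hqw j] at hy'
      obtain ⟨z, rfl⟩ := (ρ w).surjective y'
      rw [apply_mem_axesPerm] at hy'
      have hzC : z ∈ C := by
        have := hH.apply_mem w⁻¹ (K.inv_mem hw) _ hyC
        rwa [inv_apply_apply] at this
      have h1 := hH.diam_le _ (hq j) x' hx' z hy' hxC hzC
      have h2 := hH.le_dist hw hw1 z
      have t := hH.sc.tree.1.dist_triangle (u := z) (v := x') (w := ρ w z)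
      rw [X.dist_comm (u := z) (v := x')] at t
      omega
    · simp only [Finset.sum_const, Finset.card_range, smul_eq_mul, one_mul]
      exact Nat.mul_le_mul_left k (by omega)
  -- If `w = 1`, then `q (j + 2) = q j`; the sharper gate bound L - D applies, and 2(L - D) > L.
  · by_cases hw1 : w = 1
    · subst hw1
      refine hH.le_dist_of_periodic hb hqw hbw (γ := fun _ => 0) (B := L - D) (by omega)
        (fun j x hx y hy => Nat.zero_le _) (fun j x hx y hy p r hp hr => ?_) (fun k => ?_) v
      · rw [hqw j, map_one, Equiv.Perm.one_apply] at hy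
        have := hH.le_dist_gates_self (hne j) (hb (j + 1)) (hb1 _) hx hy hp hr
        omega
      · simp only [Finset.sum_const, Finset.card_range, smul_eq_mul, zero_add]
        rw [mul_comm 2 k, mul_assoc]
        exact Nat.mul_le_mul_left k (by omega)
    · have hex : ∀ j, ∃ x ∈ (q j).1, ∃ y ∈ (q (j + 1)).1, x ∈ C ∧ y ∈ C ∧
          ∀ x' ∈ (q j).1, ∀ y' ∈ (q (j + 1)).1, X.dist x y ≤ X.dist x' y' := by
        intro j
        obtain ⟨a, ha⟩ := nonempty_of_mem_axes hH.sc.tree (q j)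
        obtain ⟨c, hc⟩ := nonempty_of_mem_axes hH.sc.tree (q (j + 1))
        obtain ⟨⟨x, y⟩, ⟨hx, hy⟩, hmin⟩ := WellFounded.has_min
          (measure fun z : V × V => X.dist z.1 z.2).wf
          {z | z.1 ∈ (q j).1 ∧ z.2 ∈ (q (j + 1)).1} ⟨(a, c), ha, hc⟩
        obtain ⟨x', hx', y', hy', hxC, hyC, hle⟩ := hH.exists_dist_le (hq j) (hq (j + 1)) hx hy
        refine ⟨x', hx', y', hy', hxC, hyC, fun x'' hx'' y'' hy'' => hle.trans ?_⟩
        exact not_lt.1 (hmin (x'', y'') ⟨hx'', hy''⟩)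
      choose a ha c hc haC hcC hmin using hex
      -- Go from `z` to its image `c (j + 1)` under `w` through `a j`, `c j`, `a (j + 1)`. The whole
      -- displacement is at least L, and the two legs inside an axis cost at most 2D each.
      have hpair : ∀ j, L - 4 * D ≤ X.dist (a j) (c j) + X.dist (a (j + 1)) (c (j + 1)) := by
        intro j
        have hc2 := hc (j + 1)
        rw [add_assoc, hqw j] at hc2
        obtain ⟨z, hz⟩ := (ρ w).surjective (c (j + 1))
        rw [← hz, apply_mem_axesPerm] at hc2
        have hzC : z ∈ C := by
          have := hH.apply_mem w⁻¹ (K.inv_mem hw) _ (hcC (j + 1))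
          rwa [← hz, inv_apply_apply] at this
        have h1 := hH.diam_le _ (hq j) z hc2 (a j) (ha j) hzC (haC j)
        have h2 := hH.le_dist hw hw1 z
        have h3 := hH.diam_le _ (hq (j + 1)) (c j) (hc j) (a (j + 1)) (ha _) (hcC j) (haC _)
        rw [hz] at h2
        have t1 := hH.sc.tree.1.dist_triangle (u := z) (v := a j) (w := c (j + 1))
        have t2 := hH.sc.tree.1.dist_triangle (u := a j) (v := c j) (w := c (j + 1))
        have t3 := hH.sc.tree.1.dist_triangle (u := c j) (v := a (j + 1)) (w := c (j + 1))
        omega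
      refine hH.le_dist_of_periodic hb hqw hbw (γ := fun j => X.dist (a j) (c j)) (B := L - 4 * D)
        (by omega) hmin hB4 (fun k => ?_) v
      induction k with
      | zero => simp
      | succ k ih =>
        rw [show 2 * (k + 1) = 2 * k + 1 + 1 by ring, Finset.sum_range_succ, Finset.sum_range_succ,
          add_mul]
        have := hpair (2 * k)
        omega
  · refine hH.le_dist_of_periodic hb hqw hbw (γ := fun _ => 0) (B := L - 4 * D) (by omega)
      (fun j x hx y hy => Nat.zero_le _) hB4 (fun k => ?_) v
    simp only [Finset.sum_const, Finset.card_range, smul_eq_mul, zero_add]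
    rw [mul_comm m k, mul_assoc]
    refine Nat.mul_le_mul_left k (le_trans ?_ (Nat.mul_le_mul_right _ hm3))
    omega

end Hub

end Hub

/-! ### Cyclically reduced words. -/

section NormalForm

variable {E : Type*} [Group E] {ι : Type*}

/-- A word in the letters `b j`, continued periodically up to conjugation by `w`. -/
structure PeriodicWord (T : E →* Equiv.Perm ι) (K : Subgroup E) (L : ι → Set E) (m : ℕ) (w : E)
    (q : ℕ → ι) (b : ℕ → E) : Prop where
  mem : w ∈ K
  letter : ∀ j, b j ∈ L (q j)
  index_add : ∀ j, q (j + m) = T w (q j)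
  letter_add : ∀ j, b (j + m) = w * b j * w⁻¹

variable {T : E →* Equiv.Perm ι} {K : Subgroup E} {L : ι → Set E}

/-- Conjugation takes b_0 ⋯ b_{m-1} w to b_1 ⋯ b_{m-1} w b_0 = b_1 ⋯ b_{m-1} (w b_0 w⁻¹) w, and w
b_0 w⁻¹ is the letter b_m. -/
theorem PeriodicWord.isConj_shift {m : ℕ} {w : E} {q : ℕ → ι} {b : ℕ → E}
    (h : PeriodicWord T K L m w q b) (j : ℕ) :
    IsConj (prodUpTo b m * w) (prodUpTo (fun i => b (i + j)) m * w) := by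
  induction j with
  | zero => exact IsConj.refl _
  | succ j ih =>
    refine ih.trans (isConj_iff.2 ⟨(b j)⁻¹, ?_⟩)
    have h1 := prodUpTo_succ' (fun i => b (i + j)) m
    have h2 := prodUpTo_succ (fun i => b (i + j)) m
    have h3 := h.letter_add j
    have h4 : (fun i => b (i + 1 + j)) = fun i => b (i + (j + 1)) := by
      funext i
      congr 1
      omega
    simp only [zero_add, h4, add_comm m j, h3] at h1 h2
    rw [h1] at h2
    have h5 : prodUpTo (fun i => b (i + (j + 1))) m =
      (b j)⁻¹ * (prodUpTo (fun i => b (i + j)) m * (w * b j * w⁻¹)) := by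
      rw [← h2]
      group
    rw [h5]
    group

theorem PeriodicWord.exists_extend
    (hconj : ∀ k ∈ K, ∀ i, ∀ a ∈ L i, k * a * k⁻¹ ∈ L (T k i)) {m : ℕ} (hm : m ≠ 0) {w : E}
    (hw : w ∈ K) {r : ℕ → ι} {a : ℕ → E} (ha : ∀ j, a j ∈ L (r j)) :
    ∃ q b, PeriodicWord T K L m w q b ∧ prodUpTo b m = prodUpTo a m := by
  refine ⟨fun j => T (w ^ (j / m)) (r (j % m)),
    fun j => w ^ (j / m) * a (j % m) * (w ^ (j / m))⁻¹, ⟨hw, fun j => ?_, fun j => ?_, fun j => ?_⟩,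
    prodUpTo_congr fun i hi => ?_⟩
  · exact hconj _ (K.pow_mem hw _) _ _ (ha _)
  · rw [Nat.add_div_right _ (Nat.pos_of_ne_zero hm), Nat.add_mod_right,
      pow_succ', map_mul, Equiv.Perm.mul_apply]
  · rw [Nat.add_div_right _ (Nat.pos_of_ne_zero hm), Nat.add_mod_right,
      pow_succ']
    group
  · simp [Nat.div_eq_of_lt hi, Nat.mod_eq_of_lt hi]

/-- Elements of `K` move to the right end at the price of conjugating letters. -/
theorem exists_word (hconj : ∀ k ∈ K, ∀ i, ∀ a ∈ L i, k * a * k⁻¹ ∈ L (T k i))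
    (hgen : Submonoid.closure ((K : Set E) ∪ ⋃ i, L i) = ⊤) (x : E) :
    x ∈ K ∨ ∃ (m : ℕ) (w : E) (r : ℕ → ι) (a : ℕ → E), w ∈ K ∧ (∀ j, a j ∈ L (r j)) ∧
      x = prodUpTo a m * w := by
  induction x using Submonoid.induction_of_closure_eq_top_left hgen with
  | one => exact Or.inl K.one_mem
  | mul_left s hs y ih =>
    rcases hs with hs | hs
    · rcases ih with ih | ⟨m, w, r, a, hw, ha, rfl⟩
      · exact Or.inl (K.mul_mem hs ih)
      · refine Or.inr ⟨m, s * w, fun j => T s (r j), fun j => s * a j * s⁻¹, K.mul_mem hs hw,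
          fun j => hconj s hs _ _ (ha j), ?_⟩
        have := map_prodUpTo a (MulAut.conj s).toMonoidHom m
        simp only [MulEquiv.coe_toMonoidHom, MulAut.conj_apply] at this
        rw [← this]
        group
    · obtain ⟨i, hi⟩ := Set.mem_iUnion.1 hs
      rcases ih with ih | ⟨m, w, r, a, hw, ha, rfl⟩
      · exact Or.inr ⟨1, y, fun _ => i, fun _ => s, ih, fun _ => hi, by simp [prodUpTo_succ]⟩
      · refine Or.inr ⟨m + 1, w, fun j => Nat.casesOn j i r, fun j => Nat.casesOn j s a, hw, ?_, ?_⟩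
        · rintro (_ | j)
          · exact hi
          · exact ha j
        · rw [prodUpTo_succ', mul_assoc]
          rfl

/-- Up to conjugation, an element of a free product is elliptic or cyclically reduced. -/
theorem exists_isConj_cyclicallyReduced
    (hmul : ∀ i, ∀ a ∈ L i, ∀ b ∈ L i, a * b ∈ L i)
    (hconj : ∀ k ∈ K, ∀ i, ∀ a ∈ L i, k * a * k⁻¹ ∈ L (T k i))
    (hfree : ∀ k ∈ K, ∀ i, (L i).Nonempty → T k i = i → k = 1)
    (hgen : Submonoid.closure ((K : Set E) ∪ ⋃ i, L i) = ⊤) (x : E) :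
    (∃ y ∈ K, IsConj x y) ∨ (∃ i, ∃ y ∈ L i, IsConj x y) ∨
    ∃ (m : ℕ) (w : E) (q : ℕ → ι) (b : ℕ → E), m ≠ 0 ∧ PeriodicWord T K L m w q b ∧
      (∀ j, q j ≠ q (j + 1)) ∧ (∀ j, b j ≠ 1) ∧ IsConj x (prodUpTo b m * w) := by
  rcases exists_word hconj hgen x with hx | ⟨m, w, r, a, hw, ha, hx⟩
  · exact Or.inl ⟨x, hx, IsConj.refl x⟩
  replace hx : IsConj x (prodUpTo a m * w) := hx ▸ IsConj.refl x
  induction m generalizing r a with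
  | zero => exact Or.inl ⟨w, hw, by simpa using hx⟩
  | succ m ih =>
    obtain ⟨q, b, hP, hprod⟩ := PeriodicWord.exists_extend hconj (Nat.succ_ne_zero m) hw ha
    rw [← hprod] at hx
    by_cases h1 : ∀ j, b j ≠ 1
    · by_cases h2 : ∀ j, q j ≠ q (j + 1)
      · exact Or.inr (Or.inr ⟨m + 1, w, q, b, Nat.succ_ne_zero m, hP, h2, h1, hx⟩)
      · push Not at h2
        obtain ⟨j, hj⟩ := h2
        -- A cyclic shift brings the two letters with equal index to the front, where they merge. If
        -- there is only one letter, `w` fixes its index, so `w = 1` and the word is that letter.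
        have hx' := hx.trans (hP.isConj_shift j)
        rcases Nat.eq_zero_or_pos m with rfl | hm
        · have := hP.index_add j
          rw [Nat.succ_eq_add_one, zero_add, ← hj] at this
          obtain rfl := hfree w hw _ ⟨_, hP.letter j⟩ this.symm
          exact Or.inr (Or.inl ⟨q j, b j, hP.letter j, by simpa [prodUpTo_succ] using hx'⟩)
        · obtain ⟨m, rfl⟩ := Nat.exists_eq_succ_of_ne_zero hm.ne'
          refine ih (fun i => Nat.casesOn i (q j) fun i => q (i + 2 + j))
            (fun i => Nat.casesOn i (b j * b (j + 1)) fun i => b (i + 2 + j)) ?_ ?_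
          · rintro (_ | i)
            · exact hmul _ _ (hP.letter j) _ (hj ▸ hP.letter (j + 1))
            · exact hP.letter _
          · rw [prodUpTo_succ', prodUpTo_succ'] at hx'
            rw [Nat.succ_eq_add_one, prodUpTo_succ']
            simp only [zero_add, add_comm 1 j, ← mul_assoc] at hx' ⊢
            exact hx'
    · push Not at h1
      obtain ⟨j, hj⟩ := h1
      have hx' := hx.trans (hP.isConj_shift j)
      refine ih (fun i => q (i + 1 + j)) (fun i => b (i + 1 + j)) (fun i => hP.letter _) ?_
      rw [prodUpTo_succ', zero_add, hj, one_mul] at hx'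
      exact hx'

end NormalForm

/-! ### The free product embeds and its elements are long. -/

section FreeProduct

variable {V : Type u} {X : SimpleGraph V} {G : Type v} [Group G] {ρ : G →* (X ≃g X)}
  {g : G} {n D : ℕ} {C : Set V} {K : Subgroup G} {𝒜 : Set (axes ρ g)}

/-- The property required in a windmill of the nontrivial elements of its group. -/
def IsLong (ρ : G →* (X ≃g X)) (g : G) (n : ℕ) (f : G) : Prop :=
  IsLoxodromic (ρ f) ∧
    translationLength (ρ (g ^ n)) ≤ translationLength (ρ f) ∧
    (translationLength (ρ f) = translationLength (ρ (g ^ n)) ↔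
      IsConj f (g ^ n) ∨ IsConj f (g ^ n)⁻¹)

theorem translationLength_eq_of_isConj {a b : G} (h : IsConj a b) :
    translationLength (ρ a) = translationLength (ρ b) := by
  obtain ⟨c, rfl⟩ := isConj_iff.1 h
  rw [map_mul, map_mul, map_inv, translationLength_conj]

theorem IsLong.of_isConj {a b : G} (h : IsConj a b) (ha : IsLong ρ g n b) : IsLong ρ g n a := by
  have hl := translationLength_eq_of_isConj (ρ := ρ) h
  refine ⟨?_, hl ▸ ha.2.1, ?_⟩
  · obtain ⟨c, rfl⟩ := isConj_iff.1 h.symm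
    rw [map_mul, map_mul, map_inv]
    exact ha.1.conj _
  · rw [hl, ha.2.2]
    exact or_congr ⟨h.trans, h.symm.trans⟩ ⟨h.trans, h.symm.trans⟩

theorem IsLong.ne_one (hX : X.Connected) {a : G} (ha : IsLong ρ g n a) : a ≠ 1 := by
  rintro rfl
  have := hX.nonempty
  exact ha.1.1 (Classical.arbitrary V) (by simp)

/-- All displacements are at least two, which excludes inversions; strictness makes both sides of
the equality clause false. -/
theorem isLong_of_lt (hs : SmallCancellation ρ g n D) {f : G}
    (h : ∀ v, translationLength (ρ (g ^ n)) + 1 ≤ X.dist v (ρ f v)) : IsLong ρ g n f := by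
  have := hs.tree.1.nonempty
  have h1 := hs.lt_length
  have h2 := le_translationLength h
  refine ⟨IsLoxodromic.of_two_le fun v => le_trans (by omega) (h v), by omega, ?_⟩
  constructor
  · omega
  · rintro (hc | hc)
    · exact translationLength_eq_of_isConj hc
    · rw [translationLength_eq_of_isConj hc, map_inv, translationLength_inv]

/-- `S` meets each `K`-orbit in `𝒜` exactly once. -/
structure IsTransversal (K : Subgroup G) (𝒜 S : Set (axes ρ g)) : Prop where
  subset : S ⊆ 𝒜
  exists_eq : ∀ Q ∈ 𝒜, ∃ k ∈ K, ∃ c ∈ S, axesPerm ρ g k c = Q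
  unique : ∀ c ∈ S, ∀ c' ∈ S, ∀ k ∈ K, axesPerm ρ g k c = c' → c = c'

theorem exists_isTransversal (K : Subgroup G) {𝒜 : Set (axes ρ g)}
    (h𝒜 : ∀ k ∈ K, ∀ Q ∈ 𝒜, axesPerm ρ g k Q ∈ 𝒜) : ∃ S, IsTransversal K 𝒜 S := by
  let s : Setoid (axes ρ g) :=
    { r := fun Q R => ∃ k ∈ K, axesPerm ρ g k Q = R
      iseqv :=
        { refl := fun Q => ⟨1, K.one_mem, by simp⟩
          symm := by
            rintro Q R ⟨k, hk, rfl⟩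
            exact ⟨k⁻¹, K.inv_mem hk, by simp⟩
          trans := by
            rintro Q R P ⟨k, hk, rfl⟩ ⟨l, hl, rfl⟩
            exact ⟨l * k, K.mul_mem hl hk, by simp⟩ } }
  refine ⟨{Q | Q ∈ 𝒜 ∧ (Quotient.mk s Q).out = Q}, fun Q hQ => hQ.1, fun Q hQ => ?_, ?_⟩
  · obtain ⟨k, hk, h⟩ : s (Quotient.mk s Q).out Q := Quotient.mk_out (s := s) Q
    refine ⟨k, hk, (Quotient.mk s Q).out, ⟨?_, ?_⟩, h⟩
    · have := h𝒜 k⁻¹ (K.inv_mem hk) Q hQ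
      rw [← h] at this
      simpa using this
    · rw [Quotient.out_eq]
  · rintro c ⟨-, hc⟩ c' ⟨-, hc'⟩ k hk h
    rw [← hc, ← hc', Quotient.sound (s := s) ⟨k, hk, h⟩]

variable (K) (n) in
/-- The homomorphism from the free product of `K` and of the apex groups `G_c`, `c ∈ S`. -/
def freeProductHom (S : Set (axes ρ g)) :
    Monoid.Coprod K (Monoid.CoprodI fun c : S => apexGroup ρ n c.1) →* G :=
  Monoid.Coprod.lift K.subtype (Monoid.CoprodI.lift fun c : S => (apexGroup ρ n c.1).subtype)

variable (K) (n) in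
/-- The conjugates by `K`, in the free product, of the factor attached to an axis. -/
def letters (S : Set (axes ρ g)) (Q : axes ρ g) :
    Set (Monoid.Coprod K (Monoid.CoprodI fun c : S => apexGroup ρ n c.1)) :=
  {e | ∃ (k : K) (c : S) (s : apexGroup ρ n c.1), axesPerm ρ g k c.1 = Q ∧
    e = Monoid.Coprod.inl k *
      Monoid.Coprod.inr (Monoid.CoprodI.of (M := fun c : S => apexGroup ρ n c.1) s) *
      (Monoid.Coprod.inl k)⁻¹}

theorem freeProductHom_inl {S : Set (axes ρ g)} (k : K) :
    freeProductHom n K S (Monoid.Coprod.inl k) = k :=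
  Monoid.Coprod.lift_apply_inl _ _ _

theorem freeProductHom_inr_of {S : Set (axes ρ g)} (c : S) (s : apexGroup ρ n c.1) :
    freeProductHom n K S (Monoid.Coprod.inr
      (Monoid.CoprodI.of (M := fun c : S => apexGroup ρ n c.1) s)) = s := by
  unfold freeProductHom
  rw [Monoid.Coprod.lift_apply_inr, Monoid.CoprodI.lift_of]
  rfl

theorem freeProductHom_mem_of_mem_letters {S : Set (axes ρ g)} {Q : axes ρ g}
    {e : Monoid.Coprod K (Monoid.CoprodI fun c : S => apexGroup ρ n c.1)}
    (he : e ∈ letters n K S Q) : freeProductHom n K S e ∈ apexGroup ρ n Q := by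
  obtain ⟨k, c, s, rfl, rfl⟩ := he
  rw [map_mul, map_mul, map_inv, freeProductHom_inl, freeProductHom_inr_of]
  exact apexGroup_conj _ s.2

theorem eq_one_of_mem_letters {S : Set (axes ρ g)} {Q : axes ρ g}
    {e : Monoid.Coprod K (Monoid.CoprodI fun c : S => apexGroup ρ n c.1)}
    (he : e ∈ letters n K S Q) (h1 : freeProductHom n K S e = 1) : e = 1 := by
  obtain ⟨k, c, s, rfl, rfl⟩ := he
  rw [map_mul, map_mul, map_inv, freeProductHom_inl, freeProductHom_inr_of] at h1
  have : s = 1 := by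
    ext
    simpa using h1
  rw [this]
  simp

theorem closure_letters (S : Set (axes ρ g)) :
    Submonoid.closure (((Monoid.Coprod.inl : K →*
      Monoid.Coprod K (Monoid.CoprodI fun c : S => apexGroup ρ n c.1)).range : Set _) ∪
      ⋃ Q, letters n K S Q) = ⊤ := by
  rw [eq_top_iff, ← Monoid.Coprod.mrange_inl_sup_mrange_inr, sup_le_iff]
  constructor
  · rintro _ ⟨k, rfl⟩
    exact Submonoid.subset_closure (Or.inl ⟨k, rfl⟩)
  · rintro _ ⟨x, rfl⟩
    induction x using Monoid.CoprodI.induction_on with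
    | one =>
      rw [map_one]
      exact one_mem _
    | of c s =>
      refine Submonoid.subset_closure (Or.inr (Set.mem_iUnion.2 ⟨c.1, 1, c, s, by simp, by simp⟩))
    | mul x y hx hy =>
      rw [map_mul]
      exact mul_mem hx hy

/-- Being long is invariant under conjugation, so the three normal forms suffice. Working with
abstract elements gives injectivity as well, since long elements are nontrivial. -/
theorem Hub.isLong (hH : Hub ρ g n D C K 𝒜) {S : Set (axes ρ g)} (hS : IsTransversal K 𝒜 S)
    {e : Monoid.Coprod K (Monoid.CoprodI fun c : S => apexGroup ρ n c.1)} (he : e ≠ 1) :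
    IsLong ρ g n (freeProductHom n K S e) := by
  set F := freeProductHom n K S with hF
  have hS𝒜 : ∀ Q, (letters n K S Q).Nonempty → Q ∈ 𝒜 := by
    rintro _ ⟨_, k, c, s, rfl, -⟩
    exact hH.perm_mem _ k.2 _ (hS.subset c.2)
  -- Transversality and freeness make the pair `(k, c)` unique for given `Q`, so the letters at `Q`
  -- form a single conjugate of one factor.
  have hmul : ∀ Q, ∀ a ∈ letters n K S Q, ∀ b ∈ letters n K S Q, a * b ∈ letters n K S Q := by
    rintro Q _ ⟨k, c, s, rfl, rfl⟩ _ ⟨k', c', s', hk, rfl⟩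
    have h1 : axesPerm ρ g (k⁻¹ * k' : G) c'.1 = c.1 := by
      rw [map_mul, Equiv.Perm.mul_apply, hk, ← Equiv.Perm.mul_apply, ← map_mul]
      simp
    have h2 : (k⁻¹ * k' : G) ∈ K := K.mul_mem (K.inv_mem k.2) k'.2
    obtain rfl : c' = c := Subtype.ext (hS.unique _ c'.2 _ c.2 _ h2 h1)
    have h3 := hH.eq_one_of_perm_eq h2 (hS.subset c'.2) h1
    obtain rfl : k = k' := Subtype.ext (inv_mul_eq_one.1 h3)
    refine ⟨k, c', s * s', rfl, ?_⟩
    rw [map_mul, map_mul]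
    group
  have hconj : ∀ k ∈ (Monoid.Coprod.inl : K →*
      Monoid.Coprod K (Monoid.CoprodI fun c : S => apexGroup ρ n c.1)).range, ∀ Q,
      ∀ a ∈ letters n K S Q, k * a * k⁻¹ ∈ letters n K S (((axesPerm ρ g).comp F) k Q) := by
    rintro _ ⟨l, rfl⟩ Q _ ⟨k, c, s, rfl, rfl⟩
    refine ⟨l * k, c, s, ?_, ?_⟩
    · rw [MonoidHom.comp_apply, hF, freeProductHom_inl, Subgroup.coe_mul, map_mul]
      rfl
    · rw [map_mul]
      group
  have hfree : ∀ k ∈ (Monoid.Coprod.inl : K →*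
      Monoid.Coprod K (Monoid.CoprodI fun c : S => apexGroup ρ n c.1)).range, ∀ Q,
      (letters n K S Q).Nonempty → ((axesPerm ρ g).comp F) k Q = Q → k = 1 := by
    rintro _ ⟨l, rfl⟩ Q hQ h
    rw [MonoidHom.comp_apply, hF, freeProductHom_inl] at h
    have : l = 1 := Subtype.ext (hH.eq_one_of_perm_eq l.2 (hS𝒜 Q hQ) h)
    rw [this, map_one]
  have hne : ∀ y, IsConj e y → y ≠ 1 := by
    rintro y hy rfl
    exact he (isConj_one_left.1 hy)
  rcases exists_isConj_cyclicallyReduced hmul hconj hfree (closure_letters S) e with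
    ⟨_, ⟨k, rfl⟩, hy⟩ | ⟨Q, y, hyQ, hy⟩ | ⟨m, w, q, b, hm, hP, hq, hb, hy⟩
  · refine IsLong.of_isConj (F.map_isConj hy) ?_
    rw [hF, freeProductHom_inl]
    refine hH.loxodromic _ k.2 ?_
    have := hne _ hy
    rintro h
    exact this (by rw [show k = 1 from Subtype.ext h, map_one])
  · refine IsLong.of_isConj (F.map_isConj hy) ?_
    exact hH.sc.apexGroup_loxodromic (freeProductHom_mem_of_mem_letters hyQ)
      fun h => hne _ hy (eq_one_of_mem_letters hyQ h)
  · refine IsLong.of_isConj (F.map_isConj hy) (isLong_of_lt hH.sc ?_)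
    rw [map_mul, map_prodUpTo]
    obtain ⟨k, rfl⟩ := hP.mem
    have hFk : F (Monoid.Coprod.inl k) = k := freeProductHom_inl k
    refine hH.lt_dist_of_cyclicallyReduced (fun j => hS𝒜 _ ⟨_, hP.letter j⟩) hq
      (fun j => freeProductHom_mem_of_mem_letters (hP.letter j))
      (fun j h => hb j (eq_one_of_mem_letters (hP.letter j) h)) hm (hFk ▸ k.2) (fun j => ?_)
      (fun j => ?_)
    · rw [hP.index_add]
      rfl
    · rw [hP.letter_add, map_mul, map_mul, map_inv]

theorem Hub.freeProductHom_injective (hH : Hub ρ g n D C K 𝒜) {S : Set (axes ρ g)}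
    (hS : IsTransversal K 𝒜 S) : Function.Injective (freeProductHom n K S) := by
  rw [injective_iff_map_eq_one]
  intro e he
  by_contra h
  exact (hH.isLong hS h).ne_one hH.sc.tree.1 he

theorem Hub.isLong_of_mem_range (hH : Hub ρ g n D C K 𝒜) {S : Set (axes ρ g)}
    (hS : IsTransversal K 𝒜 S) {f : G} (hf : f ∈ (freeProductHom n K S).range) (h1 : f ≠ 1) :
    IsLong ρ g n f := by
  obtain ⟨e, rfl⟩ := hf
  refine hH.isLong hS ?_
  rintro rfl
  exact h1 (map_one _)

end FreeProduct

/-! ### Merging two free product decompositions. -/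

section FreeProductUnion

variable {V : Type u} {X : SimpleGraph V} {G : Type v} [Group G] {ρ : G →* (X ≃g X)}
  {g : G} {n : ℕ} {K : Subgroup G}

theorem range_lift_apexGroup (S : Set (axes ρ g)) :
    (Monoid.CoprodI.lift fun c : S => (apexGroup ρ n c.1).subtype).range =
      ⨆ Q ∈ S, apexGroup ρ n Q := by
  rw [Monoid.CoprodI.range_eq_iSup, iSup_subtype']
  simp only [Subgroup.range_subtype]

theorem range_freeProductHom (S : Set (axes ρ g)) :
    (freeProductHom n K S).range = K ⊔ ⨆ Q ∈ S, apexGroup ρ n Q := by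
  rw [freeProductHom, Monoid.Coprod.range_lift, range_lift_apexGroup, Subgroup.range_subtype]

open Classical in
/-- A free product of apex groups is enlarged by further free factors. -/
theorem IsFreeProductOfApexGroups.union {S₀ S : Set (axes ρ g)}
    (h₀ : IsFreeProductOfApexGroups ρ n S₀ K)
    (hinj : Function.Injective (freeProductHom n K S)) :
    IsFreeProductOfApexGroups ρ n (S₀ ∪ S) (freeProductHom n K S).range := by
  obtain ⟨hinj₀, hrange₀⟩ := h₀
  have hK : K = ⨆ Q ∈ S₀, apexGroup ρ n Q := by rw [← range_lift_apexGroup, hrange₀]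
  have hle : ∀ c ∈ S₀, apexGroup ρ n c ≤ K := fun c hc => by
    rw [hK]
    exact le_iSup₂_of_le c hc le_rfl
  refine ⟨?_, ?_⟩
  · let e : Monoid.CoprodI (fun c : S₀ => apexGroup ρ n c.1) ≃* K :=
      (MonoidHom.ofInjective hinj₀).trans (MulEquiv.subgroupCongr hrange₀)
    have he : ∀ (c : S₀) (s : apexGroup ρ n c.1),
        e (Monoid.CoprodI.of (M := fun c : S₀ => apexGroup ρ n c.1) s) = ⟨s, hle c c.2 s.2⟩ := by
      intro c s
      ext
      change (Monoid.CoprodI.lift fun c : S₀ => (apexGroup ρ n c.1).subtype)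
        (Monoid.CoprodI.of (M := fun c : S₀ => apexGroup ρ n c.1) s) = (s : G)
      rw [Monoid.CoprodI.lift_of]
      rfl
    -- A left inverse of `φ` is enough for injectivity, so `S₀` and `S` need not be disjoint: common
    -- indices are sent into `K`.
    let φ : Monoid.CoprodI (fun c : (S₀ ∪ S : Set _) => apexGroup ρ n c.1) →*
        Monoid.Coprod K (Monoid.CoprodI fun c : S => apexGroup ρ n c.1) :=
      Monoid.CoprodI.lift fun c =>
        if hc : c.1 ∈ S₀ then Monoid.Coprod.inl.comp (Subgroup.inclusion (hle c.1 hc))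
        else Monoid.Coprod.inr.comp
          (Monoid.CoprodI.of (M := fun c : S => apexGroup ρ n c.1) (i := ⟨c.1, c.2.resolve_left hc⟩))
    let ψ : Monoid.Coprod K (Monoid.CoprodI fun c : S => apexGroup ρ n c.1) →*
        Monoid.CoprodI (fun c : (S₀ ∪ S : Set _) => apexGroup ρ n c.1) :=
      Monoid.Coprod.lift
        ((Monoid.CoprodI.lift fun c : S₀ => Monoid.CoprodI.of
          (M := fun c : (S₀ ∪ S : Set _) => apexGroup ρ n c.1) (i := ⟨c.1, Or.inl c.2⟩)).comp
            e.symm.toMonoidHom)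
        (Monoid.CoprodI.lift fun c : S => Monoid.CoprodI.of
          (M := fun c : (S₀ ∪ S : Set _) => apexGroup ρ n c.1) (i := ⟨c.1, Or.inr c.2⟩))
    have hψφ : ψ.comp φ = MonoidHom.id _ := by
      apply Monoid.CoprodI.ext_hom
      rintro ⟨c, hc⟩
      ext s : 1
      simp only [φ, ψ, MonoidHom.comp_apply, Monoid.CoprodI.lift_of, MonoidHom.id_apply]
      by_cases h : c ∈ S₀
      · rw [dif_pos h, MonoidHom.comp_apply, Monoid.Coprod.lift_apply_inl, MonoidHom.comp_apply]
        have : e.symm.toMonoidHom (Subgroup.inclusion (hle c h) s) =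
            Monoid.CoprodI.of (M := fun c : S₀ => apexGroup ρ n c.1) (i := ⟨c, h⟩) s := by
          change e.symm _ = _
          rw [MulEquiv.symm_apply_eq, he]
          rfl
        rw [this, Monoid.CoprodI.lift_of]
      · rw [dif_neg h, MonoidHom.comp_apply, Monoid.Coprod.lift_apply_inr, Monoid.CoprodI.lift_of]
    have hφ : Function.Injective φ := by
      refine Function.LeftInverse.injective (g := ψ) fun x => ?_
      exact DFunLike.congr_fun hψφ x
    have hcomp : (Monoid.CoprodI.lift fun c : (S₀ ∪ S : Set _) => (apexGroup ρ n c.1).subtype) =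
        (freeProductHom n K S).comp φ := by
      apply Monoid.CoprodI.ext_hom
      rintro ⟨c, hc⟩
      ext s : 1
      simp only [φ, MonoidHom.comp_apply, Monoid.CoprodI.lift_of]
      by_cases h : c ∈ S₀
      · rw [dif_pos h, MonoidHom.comp_apply, freeProductHom_inl]
        rfl
      · rw [dif_neg h, MonoidHom.comp_apply, freeProductHom_inr_of]
        rfl
    rw [hcomp]
    exact hinj.comp hφ
  · rw [range_lift_apexGroup, range_freeProductHom, iSup_union, ← hK]

end FreeProductUnion

/-! ### Windmills spanned by a convex set and a set of apices. -/

section Hull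

variable {V : Type u} {X : SimpleGraph V} {G : Type v} [Group G] {ρ : G →* (X ≃g X)}
  {g : G} {n D : ℕ}

/-- The full subgraph of the cone-off on given sets of vertices of the tree and of apices. -/
def fullSubgraph (C : Set V) (A : Set (axes ρ g)) : (coneOff ρ g).Subgraph :=
  (⊤ : (coneOff ρ g).Subgraph).induce (Sum.inl '' C ∪ Sum.inr '' A)

variable {C : Set V} {A : Set (axes ρ g)}

theorem inl_mem_fullSubgraph {v : V} : Sum.inl v ∈ (fullSubgraph C A).verts ↔ v ∈ C := by
  simp [fullSubgraph]

theorem inr_mem_fullSubgraph {Q : axes ρ g} : Sum.inr Q ∈ (fullSubgraph C A).verts ↔ Q ∈ A := by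
  simp [fullSubgraph]

theorem treePart_fullSubgraph :
    treePart ρ (fullSubgraph C A) = (⊤ : X.Subgraph).induce C := by
  ext u v
  · exact inl_mem_fullSubgraph
  · exact ⟨fun h => ⟨inl_mem_fullSubgraph.1 h.2.1, inl_mem_fullSubgraph.1 h.2.2.1, h.1⟩,
      fun h => ⟨h.2.2, inl_mem_fullSubgraph.2 h.1, inl_mem_fullSubgraph.2 h.2.1, h.2.2⟩⟩

theorem apicesIn_fullSubgraph : apicesIn ρ (fullSubgraph C A) = A := by
  ext Q
  exact inr_mem_fullSubgraph

theorem cone_le_fullSubgraph {Q : axes ρ g} (hQ : Q ∈ A) (hC : Q.1 ⊆ C) :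
    cone ρ Q ≤ fullSubgraph C A := by
  apply SimpleGraph.Subgraph.induce_mono_right
  rintro _ (rfl | ⟨v, hv, rfl⟩)
  · exact Or.inr ⟨Q, hQ, rfl⟩
  · exact Or.inl ⟨v, hC hv, rfl⟩

theorem isQuasiconvex_fullSubgraph (hX : X.IsTree) (hC : IsConvex X C) (hne : C.Nonempty)
    (hA : ∀ Q ∈ A, Q.1 ⊆ C) : IsQuasiconvex ρ (fullSubgraph C A) := by
  have htree := hC.induce_connected hX.1 hne
  refine ⟨?_, by rw [treePart_fullSubgraph]; exact htree⟩
  rw [SimpleGraph.Subgraph.connected_iff]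
  obtain ⟨v₀, hv₀⟩ := hne
  refine ⟨?_, ⟨Sum.inl v₀, inl_mem_fullSubgraph.2 hv₀⟩⟩
  have hpre := htree.preconnected
  rw [SimpleGraph.Subgraph.preconnected_iff] at hpre ⊢
  let F : ((⊤ : X.Subgraph).induce C).coe →g (fullSubgraph C A).coe :=
    { toFun := fun v => ⟨Sum.inl v.1, inl_mem_fullSubgraph.2 v.2⟩
      map_rel' := by
        rintro ⟨u, hu⟩ ⟨v, hv⟩ huv
        have huv' : u ∈ C ∧ v ∈ C ∧ X.Adj u v := huv
        exact ⟨Or.inl ⟨u, hu, rfl⟩, Or.inl ⟨v, hv, rfl⟩, huv'.2.2⟩ }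
  have key : ∀ x : (fullSubgraph C A).verts, (fullSubgraph C A).coe.Reachable
      ⟨Sum.inl v₀, inl_mem_fullSubgraph.2 hv₀⟩ x := by
    rintro ⟨v | Q, hx⟩
    · exact (hpre ⟨v₀, hv₀⟩ ⟨v, inl_mem_fullSubgraph.1 hx⟩).map F
    · have hQ := inr_mem_fullSubgraph.1 hx
      obtain ⟨v, hv⟩ := nonempty_of_mem_axes hX Q
      refine ((hpre ⟨v₀, hv₀⟩ ⟨v, hA Q hQ hv⟩).map F).trans (SimpleGraph.Adj.reachable ?_)
      exact ⟨Or.inl ⟨v, hA Q hQ hv, rfl⟩, Or.inr ⟨Q, hQ, rfl⟩, hv⟩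
  exact fun x y => (key x).symm.trans (key y)

theorem isInvariant_fullSubgraph {P : Subgroup G} (hC : ∀ h ∈ P, ∀ v ∈ C, ρ h v ∈ C)
    (hA : ∀ h ∈ P, ∀ Q ∈ A, axesPerm ρ g h Q ∈ A) : IsInvariant ρ P (fullSubgraph C A) := by
  have hmem : ∀ h ∈ P, ∀ x ∈ (fullSubgraph C A).verts,
      coneOffAction ρ g h x ∈ (fullSubgraph C A).verts := by
    rintro h hh (v | Q) hx
    · exact inl_mem_fullSubgraph.2 (hC h hh v (inl_mem_fullSubgraph.1 hx))
    · exact inr_mem_fullSubgraph.2 (hA h hh Q (inr_mem_fullSubgraph.1 hx))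
  have hle : ∀ h ∈ P, (fullSubgraph C A).map (coneOffAction ρ g h).toHom ≤ fullSubgraph C A := by
    intro h hh
    rw [SimpleGraph.Subgraph.map_le_iff_le_comap]
    refine ⟨hmem h hh, fun x y hxy => ⟨hxy.adj_sub, ?_⟩⟩
    exact ⟨hmem h hh _ hxy.1, hmem h hh _ hxy.2.1, (coneOffAction ρ g h).map_rel_iff.2 hxy.2.2⟩
  intro h hh
  refine le_antisymm (hle h hh) ?_
  have h1 := hle h⁻¹ (P.inv_mem hh)
  have h2 := SimpleGraph.Subgraph.map_mono (f := (coneOffAction ρ g h).toHom) h1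
  rw [← SimpleGraph.Subgraph.map_comp] at h2
  convert h2
  convert (SimpleGraph.Subgraph.map_id _).symm
  ext x : 1
  change coneOffAction ρ g h (coneOffAction ρ g h⁻¹ x) = x
  rw [← RelIso.mul_apply, ← map_mul, mul_inv_cancel, map_one, RelIso.one_apply]

theorem SmallCancellation.exists_dist_gt (hs : SmallCancellation ρ g n D) (Q : axes ρ g) (N : ℕ) :
    ∃ x ∈ Q.1, ∃ y ∈ Q.1, N < X.dist x y := by
  obtain ⟨x, hx⟩ := nonempty_of_mem_axes hs.tree Q
  obtain ⟨Q, φ, rfl⟩ := Q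
  have hlox : IsLoxodromic (ρ (φ * g * φ⁻¹)) := by
    rw [map_mul, map_mul, map_inv]
    exact hs.lox.conj _
  refine ⟨x, hx, _, pow_apply_mem_axis hx (N + 1), ?_⟩
  rw [hlox.dist_pow hs.tree hx]
  exact Nat.lt_of_succ_le (Nat.le_mul_of_pos_right _ (hlox.translationLength_pos hs.tree.1))

theorem setDiam_le_iff (hX : X.Connected) {S : Set V} {N : ℕ} :
    setDiam X S ≤ N ↔ ∀ x ∈ S, ∀ y ∈ S, X.dist x y ≤ N := by
  unfold setDiam
  simp only [iSup_le_iff]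
  refine forall₂_congr fun x _ => forall₂_congr fun y _ => ?_
  rw [← (hX x y).coe_dist_eq_edist]
  exact Nat.cast_le

/-- Construction of windmills from convex sets. -/
theorem isWindmill_fullSubgraph (hs : SmallCancellation ρ g n D) (hD : Delta ρ g = D)
    {P : Subgroup G} (hC : IsConvex X C) (hne : C.Nonempty)
    (hCP : ∀ h ∈ P, ∀ v ∈ C, ρ h v ∈ C) (hAP : ∀ h ∈ P, ∀ Q ∈ A, axesPerm ρ g h Q ∈ A)
    (hP : ⨆ Q ∈ A, apexGroup ρ n Q = P) (hAC : ∀ Q ∈ A, Q.1 ⊆ C)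
    (hdiam : ∀ Q ∉ A, ∀ x ∈ Q.1, ∀ y ∈ Q.1, x ∈ C → y ∈ C → X.dist x y ≤ 2 * D)
    (hfree : ∃ S ⊆ A, IsFreeProductOfApexGroups ρ n S P)
    (hlong : ∀ f ∈ P, f ≠ 1 → IsLong ρ g n f) :
    groupOf ρ n (fullSubgraph C A) = P ∧ IsWindmill ρ n (fullSubgraph C A) := by
  have hgroup : groupOf ρ n (fullSubgraph C A) = P := by
    unfold groupOf
    rw [apicesIn_fullSubgraph, hP]
  have hverts : (treePart ρ (fullSubgraph C A)).verts = C := by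
    rw [treePart_fullSubgraph]
    rfl
  refine ⟨hgroup, isQuasiconvex_fullSubgraph hs.tree hC hne hAC, ?_, ?_, ?_, ?_, ?_⟩
  · refine le_antisymm (le_sInf fun B hB => hB.1) (sInf_le ⟨le_rfl, ?_⟩)
    rw [hgroup]
    exact isInvariant_fullSubgraph hCP hAP
  · intro Q hQ
    have hQA : Q ∈ A := by
      rcases hQ with hQ | hQ
      · exact inr_mem_fullSubgraph.1 hQ
      -- Axes are unbounded, so one contained in `C` cannot satisfy the overlap bound imposed
      -- outside `A`.
      · by_contra hQA
        have hsub : Q.1 ⊆ C := by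
          rw [← hverts]
          exact hQ.1
        obtain ⟨x, hx, y, hy, hxy⟩ := hs.exists_dist_gt Q (2 * D)
        have := hdiam Q hQA x hx y hy (hsub hx) (hsub hy)
        omega
    exact cone_le_fullSubgraph hQA (hAC Q hQA)
  · rintro Q ⟨-, hQ⟩
    rw [hverts, hD, show (2 * (D : ℕ∞)) = ((2 * D : ℕ) : ℕ∞) by push_cast; rfl,
      setDiam_le_iff hs.tree.1]
    exact fun x hx y hy => hdiam Q (fun h => hQ (inr_mem_fullSubgraph.2 h)) x hx.1 y hy.1 hx.2 hy.2
  · rw [hgroup, apicesIn_fullSubgraph]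
    exact hfree
  · rw [hgroup]
    exact hlong

end Hull

/-! ### From a windmill to a hub. -/

section Windmill

variable {V : Type u} {X : SimpleGraph V} {G : Type v} [Group G] {ρ : G →* (X ≃g X)}
  {g : G} {n D : ℕ} {W : (coneOff ρ g).Subgraph}

theorem smallCancellation (hX : X.IsTree) (hlox : IsLoxodromic (ρ g))
    (hn : 7 * Delta ρ g < (translationLength (ρ (g ^ n)) : ℕ∞))
    (hwd : ∀ φ : G, axis (ρ (φ * g * φ⁻¹)) = axis (ρ g) →
      Subgroup.zpowers (φ * g ^ n * φ⁻¹) = Subgroup.zpowers (g ^ n)) :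
    ∃ D : ℕ, Delta ρ g = D ∧ SmallCancellation ρ g n D := by
  -- The strict inequality in `hn` makes Δ finite, so all later estimates take place in ℕ.
  have hfin : Delta ρ g ≠ ⊤ := by
    intro h
    rw [h, ENat.mul_top (by norm_num)] at hn
    exact not_top_lt hn
  obtain ⟨D, hD⟩ := ENat.ne_top_iff_exists.1 hfin
  refine ⟨D, hD.symm, hX, hlox, ?_, fun Q R hQR x hxQ y hyQ hxR hyR => ?_, hwd⟩
  · rw [← hD] at hn
    exact_mod_cast hn
  · have h1 : setDiam X (Q.1 ∩ R.1) ≤ (D : ℕ∞) := by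
      rw [hD]
      unfold Delta
      exact le_iSup₂_of_le Q.1 Q.2 (le_iSup₂_of_le R.1 R.2
        (le_iSup_of_le (fun h => hQR (Subtype.ext h)) le_rfl))
    exact (setDiam_le_iff hX.1).1 h1 x ⟨hxQ, hxR⟩ y ⟨hyQ, hyR⟩

theorem IsSaturated.apply_mem (hW : IsSaturated ρ n W) {h : G} (hh : h ∈ groupOf ρ n W)
    {x : V ⊕ axes ρ g} (hx : x ∈ W.verts) : coneOffAction ρ g h x ∈ W.verts := by
  have hle : W.map (coneOffAction ρ g h).toHom ≤ W := by
    conv_rhs => rw [hW]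
    refine le_sInf fun B hB => ?_
    rw [← hB.2 h hh]
    exact SimpleGraph.Subgraph.map_mono hB.1
  exact hle.1 ⟨x, hx, rfl⟩

theorem IsWindmill.subset_of_mem (hW : IsWindmill ρ n W) {Q : axes ρ g} (hQ : Q ∈ apicesIn ρ W) :
    Q.1 ⊆ (treePart ρ W).verts := fun v hv =>
  (hW.complete Q (Or.inl hQ)).1 (Or.inr ⟨v, hv, rfl⟩)

theorem IsWindmill.perm_mem (hW : IsWindmill ρ n W) {h : G} (hh : h ∈ groupOf ρ n W)
    {Q : axes ρ g} (hQ : Q ∈ apicesIn ρ W) : axesPerm ρ g h Q ∈ apicesIn ρ W :=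
  hW.saturated.apply_mem hh hQ

theorem IsWindmill.hub (hs : SmallCancellation ρ g n D) (hD : Delta ρ g = D)
    (hW : IsWindmill ρ n W) :
    Hub ρ g n D (treePart ρ W).verts (groupOf ρ n W) (adjacentApices ρ W) where
  sc := hs
  convex := isConvex_verts_of_connected hs.tree hW.quasiconvex.2
  apply_mem k hk v hv := hW.saturated.apply_mem hk hv
  perm_mem k hk Q hQ := by
    obtain ⟨⟨v, hvQ, hv⟩, hQW⟩ := hQ
    refine ⟨⟨ρ k v, (apply_mem_axesPerm ρ).2 hvQ, hW.saturated.apply_mem hk hv⟩, fun h => hQW ?_⟩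
    have := hW.perm_mem (inv_mem hk) h
    exact (by simpa using this : Q ∈ apicesIn ρ W)
  meets Q hQ := hQ.1
  diam_le Q hQ x hx y hy hxC hyC := by
    have := hW.diam_adjacent Q hQ
    rw [hD, show (2 * (D : ℕ∞)) = ((2 * D : ℕ) : ℕ∞) by push_cast; rfl,
      setDiam_le_iff hs.tree.1] at this
    exact this x ⟨hx, hxC⟩ y ⟨hy, hyC⟩
  loxodromic := hW.loxodromic

/-- Every axis meets `W` and none is adjacent, so all apices are in `W`. Completeness gives the cone
edges and connectedness the tree edges. -/
theorem IsWindmill.eq_top (hX : X.IsTree) (hW : IsWindmill ρ n W)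
    (hC : (treePart ρ W).verts = Set.univ) (hA : adjacentApices ρ W = ∅) : W = ⊤ := by
  have hapex : ∀ Q : axes ρ g, cone ρ Q ≤ W := by
    intro Q
    refine hW.complete Q (Or.inl ?_)
    by_contra hQ
    obtain ⟨v, hv⟩ := nonempty_of_mem_axes hX Q
    have : Q ∈ adjacentApices ρ W := ⟨⟨v, hv, by rw [hC]; trivial⟩, hQ⟩
    rw [hA] at this
    exact this
  refine eq_top_iff.2 ⟨?_, ?_⟩
  · rintro (v | Q) -
    · change v ∈ (treePart ρ W).verts
      rw [hC]
      trivial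
    · exact (hapex Q).1 (Or.inl rfl)
  · have hedge : ∀ v (Q : axes ρ g), v ∈ Q.1 → W.Adj (Sum.inl v) (Sum.inr Q) := fun v Q hv =>
      (hapex Q).2 ⟨Or.inr ⟨v, hv, rfl⟩, Or.inl rfl, hv⟩
    rintro (u | Q) (v | R) h
    · have : (treePart ρ W).Adj u v := adj_of_connected hX hW.quasiconvex.2 (by rw [hC]; trivial)
        (by rw [hC]; trivial) h
      exact this.2
    · exact hedge u R h
    · exact (hedge v Q h).symm
    · exact h.elim

theorem lt_fullSubgraph {C : Set V} {A : Set (axes ρ g)} (hC : (treePart ρ W).verts ⊆ C)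
    (hA : apicesIn ρ W ⊆ A) (h : (∃ v ∈ C, v ∉ (treePart ρ W).verts) ∨ ∃ Q ∈ A, Q ∉ apicesIn ρ W) :
    W < fullSubgraph C A := by
  have hle : W ≤ fullSubgraph C A := by
    refine SimpleGraph.Subgraph.le_induce_top_verts.trans
      (SimpleGraph.Subgraph.induce_mono_right ?_)
    rintro (v | Q) hx
    · exact Or.inl ⟨v, hC hx, rfl⟩
    · exact Or.inr ⟨Q, hA hx, rfl⟩
  refine lt_of_le_not_ge hle fun hge => ?_
  rcases h with ⟨v, hv, hvW⟩ | ⟨Q, hQ, hQW⟩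
  · exact hvW (hge.1 (inl_mem_fullSubgraph.2 hv))
  · exact hQW (hge.1 (inr_mem_fullSubgraph.2 hQ))

end Windmill

/-! ### The enlarged convex set and its overlap with other axes. -/

section Growing

variable {V : Type u} {X : SimpleGraph V} {G : Type v} [Group G] {ρ : G →* (X ≃g X)}
  {g : G} {n D : ℕ} {C : Set V} {K : Subgroup G} {𝒜 : Set (axes ρ g)}

variable (n K 𝒜) in
/-- The group generated by `K` and the apex groups of the axes in `𝒜`. -/
def hubGroup : Subgroup G :=
  Subgroup.closure ((K : Set G) ∪ {b | ∃ Q ∈ 𝒜, b ∈ apexGroup ρ n Q})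

theorem le_hubGroup : K ≤ hubGroup n K 𝒜 := fun _ hk => Subgroup.subset_closure (Or.inl hk)

theorem apexGroup_le_hubGroup {Q : axes ρ g} (hQ : Q ∈ 𝒜) : apexGroup ρ n Q ≤ hubGroup n K 𝒜 :=
  fun _ hb => Subgroup.subset_closure (Or.inr ⟨Q, hQ, hb⟩)

@[elab_as_elim]
theorem hubGroup_induction {p : G → Prop} (one : p 1)
    (mul : ∀ k ∈ K, ∀ h ∈ hubGroup n K 𝒜, p h → p (k * h))
    (apex : ∀ Q ∈ 𝒜, ∀ b ∈ apexGroup ρ n Q, ∀ h ∈ hubGroup n K 𝒜, p h → p (b * h))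
    (h : G) (hh : h ∈ hubGroup n K 𝒜) : p h := by
  induction hh using Subgroup.closure_induction_left with
  | one => exact one
  | mul_left x hx y hy ih =>
    rcases hx with hx | ⟨Q, hQ, hx⟩
    · exact mul x hx y hy ih
    · exact apex Q hQ x hx y hy ih
  | inv_mul_cancel x hx y hy ih =>
    rcases hx with hx | ⟨Q, hQ, hx⟩
    · exact mul _ (K.inv_mem hx) y hy ih
    · exact apex Q hQ _ (inv_mem hx) y hy ih

/-- Every axis in `𝒜` is a `K`-translate of one in `S`, and its apex group is the corresponding
conjugate. -/
theorem IsTransversal.range_freeProductHom_eq {S : Set (axes ρ g)} (hS : IsTransversal K 𝒜 S) :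
    (freeProductHom n K S).range = hubGroup n K 𝒜 := by
  rw [range_freeProductHom]
  apply le_antisymm
  · refine sup_le le_hubGroup (iSup₂_le fun Q hQ => apexGroup_le_hubGroup (hS.subset hQ))
  · unfold hubGroup
    rw [Subgroup.closure_le]
    rintro b (hb | ⟨Q, hQ, hb⟩)
    · exact Subgroup.mem_sup_left hb
    · obtain ⟨k, hk, c, hc, rfl⟩ := hS.exists_eq Q hQ
      have h1 := apexGroup_conj k⁻¹ hb
      rw [← Equiv.Perm.mul_apply, ← map_mul, inv_mul_cancel, map_one, Equiv.Perm.one_apply,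
        inv_inv] at h1
      have hkP : k ∈ K ⊔ ⨆ Q ∈ S, apexGroup ρ n Q := Subgroup.mem_sup_left hk
      have hcP : k⁻¹ * b * k ∈ K ⊔ ⨆ Q ∈ S, apexGroup ρ n Q :=
        Subgroup.mem_sup_right ((le_iSup₂_of_le c hc le_rfl : apexGroup ρ n c ≤ _) h1)
      have := mul_mem (mul_mem hkP hcP) (inv_mem hkP)
      have e : k * (k⁻¹ * b * k) * k⁻¹ = b := by group
      rwa [e] at this

variable (n C K 𝒜) in
/-- The union of the translates of `C` and of the axes in `𝒜`. -/
def spread : Set V :=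
  {v | ∃ h ∈ hubGroup n K 𝒜, ∃ x, (x ∈ C ∨ ∃ Q ∈ 𝒜, x ∈ Q.1) ∧ ρ h x = v}

theorem subset_spread : C ⊆ spread n C K 𝒜 := fun v hv => ⟨1, one_mem _, v, Or.inl hv, by simp⟩

theorem axis_subset_spread {Q : axes ρ g} (hQ : Q ∈ 𝒜) : Q.1 ⊆ spread n C K 𝒜 := fun v hv =>
  ⟨1, one_mem _, v, Or.inr ⟨Q, hQ, hv⟩, by simp⟩

theorem apply_mem_spread {h : G} (hh : h ∈ hubGroup n K 𝒜) {v : V} (hv : v ∈ spread n C K 𝒜) :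
    ρ h v ∈ spread n C K 𝒜 := by
  obtain ⟨k, hk, x, hx, rfl⟩ := hv
  exact ⟨h * k, mul_mem hh hk, x, hx, by rw [map_mul, RelIso.mul_apply]⟩

/-- Being joined by a geodesic inside the spread is transitive, because two sides of a tripod cover
the third. So it suffices to join each point to a base point of `C`: generators from `K` preserve
`C`, and those from an apex group are crossed along an axis meeting `C`. -/
theorem Hub.isConvex_spread (hH : Hub ρ g n D C K 𝒜) (hne : C.Nonempty) :
    IsConvex X (spread n C K 𝒜) := by
  have hX := hH.sc.tree
  let R : V → V → Prop := fun a b => ∀ m, Between X a m b → m ∈ spread n C K 𝒜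
  have htrans : ∀ {a b c}, R a b → R b c → R a c := fun {a b c} h1 h2 m hm =>
    (hm.or hX b).elim (h1 m) (h2 m)
  have hsymm : ∀ {a b}, R a b → R b a := fun h m hm => h m hm.symm
  have hmap : ∀ h ∈ hubGroup n K 𝒜, ∀ {a b}, R a b → R (ρ h a) (ρ h b) := by
    intro h hh a b hab m hm
    obtain ⟨m, rfl⟩ := (ρ h).surjective m
    refine apply_mem_spread hh (hab m ?_)
    have := hm.map (ρ h⁻¹)
    simpa only [inv_apply_apply] using this
  have hC : ∀ a ∈ C, ∀ b ∈ C, R a b := fun a ha b hb m hm =>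
    subset_spread (hH.convex a ha b hb m hm)
  have hQ : ∀ Q ∈ 𝒜, ∀ a ∈ Q.1, ∀ b ∈ Q.1, R a b := fun Q hQ a ha b hb m hm =>
    axis_subset_spread hQ (isConvex_of_mem_axes hX Q a ha b hb m hm)
  obtain ⟨x₀, hx₀⟩ := hne
  have hbase : ∀ h ∈ hubGroup n K 𝒜, R (ρ h x₀) x₀ := by
    intro h hh
    refine hubGroup_induction (p := fun h => R (ρ h x₀) x₀) ?_ ?_ ?_ h hh
    · rw [map_one]
      exact hC _ hx₀ _ hx₀
    · intro k hk h hh ih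
      rw [map_mul, RelIso.mul_apply]
      exact htrans (hmap k (le_hubGroup hk) ih) (hC _ (hH.apply_mem k hk _ hx₀) _ hx₀)
    · intro Q hQ' b hb h hh ih
      rw [map_mul, RelIso.mul_apply]
      obtain ⟨p, hpQ, hpC⟩ := hH.meets Q hQ'
      have hbP := apexGroup_le_hubGroup (K := K) hQ' hb
      have hbp : ρ b p ∈ Q.1 := by
        rw [← hH.sc.axesPerm_eq_self hb, apply_mem_axesPerm]
        exact hpQ
      exact htrans (hmap b hbP (htrans ih (hC _ hx₀ _ hpC)))
        (htrans (hQ Q hQ' _ hbp _ hpQ) (hC _ hpC _ hx₀))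
  have hall : ∀ a ∈ spread n C K 𝒜, R a x₀ := by
    rintro _ ⟨h, hh, x, hx | ⟨Q, hQ', hx⟩, rfl⟩
    · exact htrans (hmap h hh (hC _ hx _ hx₀)) (hbase h hh)
    · obtain ⟨p, hpQ, hpC⟩ := hH.meets Q hQ'
      exact htrans (hmap h hh (htrans (hQ Q hQ' _ hx _ hpQ) (hC _ hpC _ hx₀))) (hbase h hh)
  exact fun a ha b hb m hm => htrans (hall a ha) (hsymm (hall b hb)) m hm

variable (n 𝒜) in
/-- `(q, b)` is a reduced chain of length `m` from `Q` to `R`. -/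
structure ReducedChain (m : ℕ) (q : ℕ → axes ρ g) (b : ℕ → G) (Q R : axes ρ g) : Prop where
  mem : ∀ j, q j ∈ 𝒜
  letter : ∀ j, b j ∈ apexGroup ρ n (q j)
  ne : ∀ j < m, q j ≠ q (j + 1)
  -- Only interior letters create a turn: `b 0` moves the rest of the chain along its first axis,
  -- and letters from `m` on do not enter `axisChain q b m`.
  ne_one : ∀ j, 0 < j → j < m → b j ≠ 1
  start : q 0 = Q
  finish : axisChain q b m = R

theorem ReducedChain.map {m : ℕ} {q : ℕ → axes ρ g} {b : ℕ → G} {Q R : axes ρ g}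
    (h : ReducedChain n 𝒜 m q b Q R) {k : G} (hk : ∀ Q ∈ 𝒜, axesPerm ρ g k Q ∈ 𝒜) :
    ReducedChain n 𝒜 m (fun j => axesPerm ρ g k (q j)) (fun j => k * b j * k⁻¹)
      (axesPerm ρ g k Q) (axesPerm ρ g k R) where
  mem j := hk _ (h.mem j)
  letter j := apexGroup_conj k (h.letter j)
  ne j hj := (axesPerm ρ g k).injective.ne (h.ne j hj)
  ne_one j h0 hj hb := h.ne_one j h0 hj (conj_eq_one_iff.1 hb)
  start := by rw [h.start]
  finish := by
    rw [← h.finish]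
    have := map_prodUpTo b (MulAut.conj k).toMonoidHom m
    simp only [MulEquiv.coe_toMonoidHom, MulAut.conj_apply] at this
    unfold axisChain
    rw [← this]
    simp

theorem ReducedChain.mul_left {m : ℕ} {q : ℕ → axes ρ g} {b : ℕ → G} {Q R : axes ρ g}
    (hs : SmallCancellation ρ g n D) (h : ReducedChain n 𝒜 m q b Q R) {c : G}
    (hc : c ∈ apexGroup ρ n Q) :
    ReducedChain n 𝒜 m q (fun j => Nat.casesOn j (c * b 0) fun i => b (i + 1)) Q
      (axesPerm ρ g c R) where
  mem := h.mem
  letter := by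
    rintro (_ | j)
    · refine mul_mem ?_ (h.letter 0)
      rw [h.start]
      exact hc
    · exact h.letter (j + 1)
  ne := h.ne
  ne_one := by
    rintro (_ | j) h0 hj
    · omega
    · exact h.ne_one _ h0 hj
  start := h.start
  finish := by
    rw [← h.finish]
    rcases m with _ | m
    · simp only [axisChain, prodUpTo_zero, map_one, Equiv.Perm.one_apply, h.start]
      exact (hs.axesPerm_eq_self hc).symm
    · unfold axisChain
      rw [← Equiv.Perm.mul_apply, ← map_mul, prodUpTo_succ', prodUpTo_succ', ← mul_assoc]
      rfl

/-- `P` goes in front with letter 1, which makes `b 0` interior when `m > 0`. If that letter is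
trivial, `Q` is redundant: `P` takes its place, or `Q` is just dropped when `q 1 = P`. -/
theorem ReducedChain.exists_cons {m : ℕ} {q : ℕ → axes ρ g} {b : ℕ → G} {Q R : axes ρ g}
    (h : ReducedChain n 𝒜 m q b Q R) {P : axes ρ g} (hP : P ∈ 𝒜) :
    ∃ m q b, ReducedChain n 𝒜 m q b P R := by
  by_cases hPQ : P = Q
  · exact ⟨m, q, b, hPQ ▸ h⟩
  by_cases hb : m = 0 ∨ b 0 ≠ 1
  · refine ⟨m + 1, fun j => Nat.casesOn j P q, fun j => Nat.casesOn j 1 b, ?_, ?_, ?_, ?_, rfl, ?_⟩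
    · rintro (_ | j)
      · exact hP
      · exact h.mem j
    · rintro (_ | j)
      · exact one_mem _
      · exact h.letter j
    · rintro (_ | j) hj
      · change P ≠ q 0
        rw [h.start]
        exact hPQ
      · exact h.ne j (by omega)
    · rintro (_ | j) h0 hj
      · omega
      · rcases j with _ | j
        · exact hb.resolve_left (by omega)
        · exact h.ne_one (j + 1) (by omega) (by omega)
    · rw [← h.finish]
      unfold axisChain
      rw [prodUpTo_succ']
      change axesPerm ρ g (1 * prodUpTo b m) (q m) = _
      rw [one_mul]
  · push Not at hb
    obtain ⟨m, rfl⟩ := Nat.exists_eq_succ_of_ne_zero hb.1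
    have hfin : axesPerm ρ g (prodUpTo (fun i => b (i + 1)) m) (q (m + 1)) = R := by
      rw [← h.finish, axisChain, Nat.succ_eq_add_one, prodUpTo_succ', hb.2, one_mul]
    by_cases h1 : q 1 = P
    · exact ⟨m, fun j => q (j + 1), fun j => b (j + 1), fun j => h.mem _, fun j => h.letter _,
        fun j hj => h.ne _ (by omega), fun j h0 hj => h.ne_one _ (by omega) (by omega), h1, hfin⟩
    · refine ⟨m + 1, fun j => Nat.casesOn j P fun i => q (i + 1), b, ?_, ?_, ?_, h.ne_one, rfl, ?_⟩
      · rintro (_ | j)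
        · exact hP
        · exact h.mem _
      · rintro (_ | j)
        · rw [hb.2]
          exact one_mem _
        · exact h.letter _
      · rintro (_ | j) hj
        · exact fun h2 => h1 h2.symm
        · exact h.ne _ hj
      · rw [← hfin, axisChain, prodUpTo_succ', hb.2, one_mul]

theorem Hub.exists_reducedChain (hH : Hub ρ g n D C K 𝒜) {h : G} (hh : h ∈ hubGroup n K 𝒜)
    {Q R : axes ρ g} (hQ : Q ∈ 𝒜) (hR : R ∈ 𝒜) :
    ∃ m q b, ReducedChain n 𝒜 m q b Q (axesPerm ρ g h R) := by
  suffices H : ∀ Q ∈ 𝒜, ∃ m q b, ReducedChain n 𝒜 m q b Q (axesPerm ρ g h R) from H Q hQ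
  clear hQ Q
  refine hubGroup_induction
    (p := fun h => ∀ Q ∈ 𝒜, ∃ m q b, ReducedChain n 𝒜 m q b Q (axesPerm ρ g h R)) ?_ ?_ ?_ h hh
  · intro Q hQ
    rw [map_one, Equiv.Perm.one_apply]
    have : ReducedChain n 𝒜 0 (fun _ => R) (fun _ => 1) R R :=
      ⟨fun _ => hR, fun _ => one_mem _, by simp, by simp, rfl, by simp [axisChain]⟩
    exact this.exists_cons hQ
  · intro k hk h hh ih Q hQ
    obtain ⟨m, q, b, H⟩ := ih _ (hH.perm_mem k⁻¹ (K.inv_mem hk) Q hQ)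
    have := H.map (hH.perm_mem k hk)
    rw [← Equiv.Perm.mul_apply, ← Equiv.Perm.mul_apply, ← map_mul, ← map_mul, mul_inv_cancel,
      map_one, Equiv.Perm.one_apply] at this
    exact ⟨_, _, _, this⟩
  · intro P hP c hc h hh ih Q hQ
    obtain ⟨m, q, b, H⟩ := ih P hP
    have := H.mul_left hH.sc hc
    rw [← Equiv.Perm.mul_apply, ← map_mul] at this
    exact this.exists_cons hQ

/-- A convex set disjoint from a convex set `C` has a point that lies in all convex sets
meeting both of them. -/
theorem exists_bridge_point (hX : X.IsTree) {R : Set V} (hC : IsConvex X C) (hR : IsConvex X R)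
    (hCne : C.Nonempty) (hRne : R.Nonempty) (hdisj : ∀ v ∈ R, v ∉ C) :
    ∃ s, ∀ c ∈ C, IsGate X R c s := by
  obtain ⟨c₀, hc₀⟩ := hCne
  obtain ⟨s, hs⟩ := hR.exists_gate hX hRne c₀
  refine ⟨s, fun c hc => ?_⟩
  obtain ⟨t, ht⟩ := hR.exists_gate hX hRne c
  by_cases hst : s = t
  · exact hst ▸ ht
  · exact absurd (hC c₀ hc₀ c hc s (hs.between_of_ne hX ht hst).1) (hdisj s hs.1)

/-- An axis outside the translates of `𝒜` that avoids the translates of `C` has small overlap with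
their union. -/
theorem Hub.dist_le_of_mem_spread (hH : Hub ρ g n D C K 𝒜) {R : axes ρ g}
    (hRC : ∀ h ∈ hubGroup n K 𝒜, ∀ v ∈ C, ρ h v ∉ R.1)
    (hR𝒜 : ∀ h ∈ hubGroup n K 𝒜, ∀ Q ∈ 𝒜, axesPerm ρ g h Q ≠ R) {x y : V} (hxR : x ∈ R.1)
    (hyR : y ∈ R.1) (hx : x ∈ spread n C K 𝒜) (hy : y ∈ spread n C K 𝒜) :
    X.dist x y ≤ 2 * D := by
  have hX := hH.sc.tree
  obtain ⟨h, hh, x, hx | ⟨Q, hQ, hx⟩, rfl⟩ := hx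
  · exact absurd hxR (hRC h hh x hx)
  obtain ⟨h', hh', y, hy | ⟨Q', hQ', hy⟩, rfl⟩ := hy
  · exact absurd hyR (hRC h' hh' y hy)
  obtain ⟨m, q, b, H⟩ := hH.exists_reducedChain (mul_mem (inv_mem hh) hh') hQ hQ'
  have hqP : ∀ j, prodUpTo b j ∈ hubGroup n K 𝒜 := by
    intro j
    induction j with
    | zero => exact one_mem _
    | succ j ih =>
      rw [prodUpTo_succ]
      exact mul_mem ih (apexGroup_le_hubGroup (H.mem j) (H.letter j))
  set z := ρ (h⁻¹ * h') y with hz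
  have hzy : ρ h' y = ρ h z := by
    rw [hz, ← RelIso.mul_apply, ← map_mul]
    congr 2
    group
  rw [hzy] at hyR ⊢
  rw [dist_aut]
  have hzm : z ∈ (axisChain q b m).1 := by
    rw [H.finish, apply_mem_axesPerm]
    exact hy
  obtain ⟨R, rfl⟩ := (axesPerm ρ g h).surjective R
  rw [apply_mem_axesPerm] at hxR hyR
  have hRC' : ∀ k ∈ hubGroup n K 𝒜, ∀ v ∈ C, ρ k v ∉ R.1 := by
    intro k hk v hv hmem
    refine hRC (h * k) (mul_mem hh hk) v hv ?_
    rw [map_mul, RelIso.mul_apply, apply_mem_axesPerm]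
    exact hmem
  have hR𝒜' : ∀ k ∈ hubGroup n K 𝒜, ∀ Q ∈ 𝒜, axesPerm ρ g k Q ≠ R := by
    rintro k hk Q hQ rfl
    refine hR𝒜 (h * k) (mul_mem hh hk) Q hQ ?_
    rw [map_mul, Equiv.Perm.mul_apply]
  have hx0 : x ∈ (axisChain q b 0).1 := by
    simpa [axisChain, H.start] using hx
  rcases (show m = 0 ∨ m = 1 ∨ 2 ≤ m by omega) with rfl | rfl | hm
  · have := hH.sc.overlap _ _ (hR𝒜' _ (hqP 0) _ (H.mem 0)) x hx0 z hzm hxR hyR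
    omega
  -- Both axes meet the same translate of `C`. The point of `R` nearest to it lies on both, so the
  -- bound 2D is the sum of two overlaps with `R`.
  · obtain ⟨R, rfl⟩ := (axesPerm ρ g (b 0)).surjective R
    have hb := apexGroup_le_hubGroup (K := K) (H.mem 0) (H.letter 0)
    obtain ⟨x, rfl⟩ := (ρ (b 0)).surjective x
    obtain ⟨z, hz'⟩ := (ρ (b 0)).surjective z
    rw [← hz'] at hyR hzm ⊢
    rw [dist_aut]
    rw [apply_mem_axesPerm] at hxR hyR
    have hx0' : x ∈ (q 0).1 := by
      rw [← apply_mem_axesPerm (ρ := ρ) (h := b 0), hH.sc.axesPerm_eq_self (H.letter 0)]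
      simpa [axisChain] using hx0
    have hz0 : z ∈ (q 1).1 := by
      rw [← apply_mem_axesPerm (ρ := ρ) (h := b 0)]
      simpa [axisChain, prodUpTo_succ] using hzm
    have hne : ∀ j, q j ≠ R := fun j hj =>
      hR𝒜' _ hb _ (H.mem j) (by rw [hj])
    have hdisj : ∀ v ∈ R.1, v ∉ C := fun v hv hvC =>
      hRC' _ hb v hvC ((apply_mem_axesPerm ρ).2 hv)
    obtain ⟨c₀, -, hc₀⟩ := hH.meets _ (H.mem 0)
    obtain ⟨s, hs⟩ := exists_bridge_point hX hH.convex (isConvex_of_mem_axes hX R) ⟨c₀, hc₀⟩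
      ⟨x, hxR⟩ hdisj
    have hsQ : ∀ j, ∀ t ∈ (q j).1, t ∈ R.1 → s ∈ (q j).1 := by
      intro j t htq htR
      obtain ⟨c, hcq, hcC⟩ := hH.meets _ (H.mem j)
      exact (hs c hcC).mem_of_inter (isConvex_of_mem_axes hX _) hcq htR htq
    have hsR := (hs c₀ hc₀).1
    have h1 := hH.sc.overlap _ _ (hne 0) x hx0' s (hsQ 0 x hx0' hxR) hxR hsR
    have h2 := hH.sc.overlap _ _ (hne 1) s (hsQ 1 z hz0 hyR) z hz0 hsR hyR
    have := hX.1.dist_triangle (u := x) (v := s) (w := z)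
    omega
  -- The geodesic from `x` to `z` lies in `R` and runs along the last axis but one of the chain for
  -- at least L - 4D > D, more than distinct axes can share.
  · exfalso
    obtain ⟨m, rfl⟩ := Nat.exists_eq_add_of_le' hm
    have hlt := hH.sc.lt_length
    have htriple : ∀ j, j + 1 < m + 2 → ∀ x ∈ (axisChain q b j).1,
        ∀ y ∈ (axisChain q b (j + 2)).1, ∀ p r, IsGate X (axisChain q b (j + 1)).1 x p →
        IsGate X (axisChain q b (j + 1)).1 y r →
        translationLength (ρ (g ^ n)) - 4 * D ≤ X.dist p r := by
      intro j hj x hx y hy p r hp hr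
      refine hH.axisChain_gates H.letter (fun x hx y hy p r hp hr => ?_) hx hy hp hr
      have := hH.le_dist_gates (H.mem _) (H.mem _) (H.mem _) (H.ne j (by omega))
        (H.ne (j + 1) hj).symm (H.letter (j + 1)) (H.ne_one _ (by omega) hj) hx hy hp hr
      omega
    have hconv : ∀ j, IsConvex X (axisChain q b j).1 := fun j => isConvex_of_mem_axes hX _
    have hnon : ∀ j, (axisChain q b j).1.Nonempty := fun j => nonempty_of_mem_axes hX _
    obtain ⟨p, hp⟩ := (hconv (m + 1)).exists_gate hX (hnon _) x
    obtain ⟨r, hr⟩ := (hconv (m + 1)).exists_gate hX (hnon _) z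
    obtain ⟨t, ht, htp⟩ := (chain_dist_le hX (fun j => (axisChain q b j).1) hconv hnon
      (translationLength (ρ (g ^ n)) - 4 * D) (fun _ => 0) (by omega)
      (fun j x _ y _ => Nat.zero_le _) m (fun j hj => htriple j (by omega)) hx0).2 p hp
    have hpr := htriple m (by omega) t ht z hzm p r htp hr
    have hne : p ≠ r := by
      rintro rfl
      rw [SimpleGraph.dist_self] at hpr
      omega
    have hb := hp.between_of_ne hX hr hne
    have hcR := isConvex_of_mem_axes hX R
    have := hH.sc.overlap (axisChain q b (m + 1)) R (hR𝒜' _ (hqP _) _ (H.mem _)) p hp.1 r hr.1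
      (hcR x hxR z hyR p hb.1) (hcR x hxR z hyR r hb.2)
    omega

end Growing

/-! ### Thickening a convex set by one edge. -/

section Neighbourhood

variable {V : Type u} {X : SimpleGraph V} {C : Set V}

/-- The neighbourhood of radius one of a set of vertices. -/
def oneNeighbourhood (X : SimpleGraph V) (C : Set V) : Set V := {v | ∃ c ∈ C, X.dist v c ≤ 1}

theorem subset_oneNeighbourhood : C ⊆ oneNeighbourhood X C := fun v hv => ⟨v, hv, by simp⟩

theorem IsConvex.oneNeighbourhood (hX : X.IsTree) (hC : IsConvex X C) :
    IsConvex X (oneNeighbourhood X C) := by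
  rintro a ⟨c, hc, hac⟩ b ⟨d, hd, hbd⟩ m hm
  rcases hm.or hX c with h | h
  · exact ⟨c, hc, by unfold Between at h; omega⟩
  · rcases h.or hX d with h | h
    · exact subset_oneNeighbourhood (hC c hc d hd m h)
    · refine ⟨d, hd, ?_⟩
      have := X.dist_comm (u := m) (v := d)
      have := X.dist_comm (u := b) (v := d)
      unfold Between at h
      omega

theorem exists_mem_oneNeighbourhood (hX : X.IsTree) (hC : IsConvex X C) (hne : C.Nonempty)
    (huniv : C ≠ Set.univ) : ∃ v ∈ oneNeighbourhood X C, v ∉ C := by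
  obtain ⟨v, hv⟩ := (Set.ne_univ_iff_exists_notMem C).1 huniv
  obtain ⟨p, hp⟩ := hC.exists_gate hX hne v
  have hpv : p ≠ v := by
    rintro rfl
    exact hv hp.1
  obtain ⟨m, hm, hm1⟩ := exists_between_dist hX.1 (hX.1.pos_dist_of_ne hpv)
  refine ⟨m, ⟨p, hp.1, by rw [X.dist_comm, hm1]⟩, fun hmC => ?_⟩
  have h1 := hp.2 m hmC
  have := X.dist_comm (u := m) (v := v)
  have := X.dist_comm (u := p) (v := v)
  unfold Between at hm
  omega

/-- A point of `R` at distance one from `C` must be the common gate in `R` of all points of `C`. -/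
theorem eq_of_mem_oneNeighbourhood (hX : X.IsTree) {R : Set V} (hC : IsConvex X C)
    (hR : IsConvex X R) (hdisj : ∀ v ∈ R, v ∉ C) {x y : V} (hxR : x ∈ R) (hyR : y ∈ R)
    (hx : x ∈ oneNeighbourhood X C) (hy : y ∈ oneNeighbourhood X C) : x = y := by
  obtain ⟨c, hc, hxc⟩ := hx
  obtain ⟨d, hd, hyd⟩ := hy
  obtain ⟨s, hs⟩ := exists_bridge_point hX hC hR ⟨c, hc⟩ ⟨x, hxR⟩ hdisj
  have key : ∀ z ∈ R, ∀ e ∈ C, X.dist z e ≤ 1 → s = z := by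
    intro z hz e he hze
    have h1 := (hs e he).2 z hz
    have hne : e ≠ s := by
      rintro rfl
      exact hdisj e (hs e he).1 he
    have h2 := hX.1.pos_dist_of_ne hne
    have := X.dist_comm (u := z) (v := e)
    exact hX.1.dist_eq_zero_iff.1 (by omega)
  exact (key x hxR c hc hxc).symm.trans (key y hyR d hd hyd)

end Neighbourhood

end ConeOff

/-! ### The growing windmills proposition. -/

theorem mainTheorem5 {V : Type*} {X : SimpleGraph V} (hX : X.IsTree)
    {G : Type*} [Group G] (ρ : G →* (X ≃g X)) (g : G)
    (hlox : ConeOff.IsLoxodromic (ρ g)) (hwpd : ConeOff.IsWPD ρ g)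
    (n : ℕ)
    (hn : 7 * ConeOff.Delta ρ g < (ConeOff.translationLength (ρ (g ^ n)) : ℕ∞))
    (hwd : ∀ φ : G, ConeOff.axis (ρ (φ * g * φ⁻¹)) = ConeOff.axis (ρ g) →
      Subgroup.zpowers (φ * g ^ n * φ⁻¹) = Subgroup.zpowers (g ^ n))
    (W : (ConeOff.coneOff ρ g).Subgraph) (hW : ConeOff.IsWindmill ρ n W) (hne : W ≠ ⊤) :
    ∃ W' : (ConeOff.coneOff ρ g).Subgraph, ConeOff.IsWindmill ρ n W' ∧ W < W' ∧
      ∃ S ⊆ ConeOff.adjacentApices ρ W,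
        ConeOff.IsFreeProductWithApexGroups ρ n (ConeOff.groupOf ρ n W) S
          (ConeOff.groupOf ρ n W') := by
  open ConeOff in
  obtain ⟨D, hD, hs⟩ := smallCancellation hX hlox hn hwd
  have hH := hW.hub hs hD
  have hCne : (treePart ρ W).verts.Nonempty := hW.quasiconvex.2.nonempty
  set K := groupOf ρ n W with hK
  set C := (treePart ρ W).verts with hC
  set 𝒜 := adjacentApices ρ W with h𝒜
  obtain ⟨S, hS⟩ := exists_isTransversal K hH.perm_mem
  have hinj := hH.freeProductHom_injective hS
  have hrange : (freeProductHom n K S).range = hubGroup n K 𝒜 := hS.range_freeProductHom_eq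
  have hlong : ∀ f ∈ hubGroup n K 𝒜, f ≠ 1 → IsLong ρ g n f := fun f hf h1 =>
    hH.isLong_of_mem_range hS (hrange ▸ hf) h1
  obtain ⟨S₀, hS₀, hfree⟩ := hW.free_product
  have hfree' : IsFreeProductOfApexGroups ρ n (S₀ ∪ S) (hubGroup n K 𝒜) :=
    hrange ▸ hfree.union hinj
  -- The algebra depends only on the group, so it remains to find a larger windmill with group
  -- `hubGroup n K 𝒜`.
  suffices H : ∃ C' A', W < fullSubgraph C' A' ∧
      groupOf ρ n (fullSubgraph C' A') = hubGroup n K 𝒜 ∧ IsWindmill ρ n (fullSubgraph C' A') by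
    obtain ⟨C', A', hlt, hgroup, hwind⟩ := H
    exact ⟨_, hwind, hlt, S, hS.subset, hinj, hrange.trans hgroup.symm⟩
  have hKA : K = ⨆ Q ∈ apicesIn ρ W, apexGroup ρ n Q := rfl
  rcases 𝒜.eq_empty_or_nonempty with hemp | ⟨Q₀, hQ₀⟩
  · have hPK : hubGroup n K 𝒜 = K := by
      refine le_antisymm ?_ le_hubGroup
      unfold hubGroup
      rw [Subgroup.closure_le]
      rintro b (hb | ⟨Q, hQ, -⟩)
      · exact hb
      · rw [hemp] at hQ
        exact hQ.elim
    have hSemp : S = ∅ := Set.subset_eq_empty hS.subset hemp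
    rw [hPK] at hlong hfree' ⊢
    -- With nothing adjacent, axes whose apex is not in `W` are disjoint from `C` and meet its
    -- neighbourhood in at most one point.
    refine ⟨oneNeighbourhood X C, apicesIn ρ W, ?_, ?_⟩
    · refine lt_fullSubgraph subset_oneNeighbourhood subset_rfl (Or.inl ?_)
      exact exists_mem_oneNeighbourhood hX hH.convex hCne fun h => hne (hW.eq_top hX h hemp)
    · refine isWindmill_fullSubgraph hs hD (hH.convex.oneNeighbourhood hX)
        (hCne.mono subset_oneNeighbourhood) ?_ (fun h hh Q hQ => hW.perm_mem hh hQ) hKA.symm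
        (fun Q hQ => (hW.subset_of_mem hQ).trans subset_oneNeighbourhood) ?_
        ⟨S₀ ∪ S, by simpa [hSemp] using hS₀, hfree'⟩ hlong
      · rintro h hh v ⟨c, hc, hvc⟩
        exact ⟨ρ h c, hH.apply_mem h hh c hc, by rwa [dist_aut]⟩
      · intro Q hQ x hxQ y hyQ hx hy
        have : x = y := by
          refine eq_of_mem_oneNeighbourhood hX hH.convex (isConvex_of_mem_axes hX Q)
            (fun v hv hvC => ?_) hxQ hyQ hx hy
          have : Q ∈ 𝒜 := ⟨⟨v, hv, hvC⟩, hQ⟩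
          rw [hemp] at this
          exact this
        simp [this]
  · set P := hubGroup n K 𝒜 with hP
    set A' : Set (axes ρ g) := {Q | ∃ h ∈ P, ∃ R ∈ apicesIn ρ W ∪ 𝒜, axesPerm ρ g h R = Q} with hA'
    have hsub : apicesIn ρ W ∪ 𝒜 ⊆ A' := fun Q hQ => ⟨1, one_mem _, Q, hQ, by simp⟩
    have hAP : ∀ h ∈ P, ∀ Q ∈ A', axesPerm ρ g h Q ∈ A' := by
      rintro h hh _ ⟨k, hk, R, hR, rfl⟩
      exact ⟨h * k, mul_mem hh hk, R, hR, by rw [map_mul, Equiv.Perm.mul_apply]⟩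
    refine ⟨spread n C K 𝒜, A', ?_, ?_⟩
    · exact lt_fullSubgraph subset_spread (Set.subset_union_left.trans hsub)
        (Or.inr ⟨Q₀, hsub (Or.inr hQ₀), hQ₀.2⟩)
    · refine isWindmill_fullSubgraph hs hD (hH.isConvex_spread hCne) (hCne.mono subset_spread)
        (fun h hh v hv => apply_mem_spread hh hv) hAP ?_ ?_ ?_
        ⟨S₀ ∪ S, Set.union_subset (hS₀.trans (Set.subset_union_left.trans hsub))
          (hS.subset.trans (Set.subset_union_right.trans hsub)), hfree'⟩ hlong
      · apply le_antisymm
        · refine iSup₂_le ?_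
          rintro _ ⟨h, hh, R, hR, rfl⟩ b hb
          have h1 := apexGroup_conj h⁻¹ hb
          rw [← Equiv.Perm.mul_apply, ← map_mul, inv_mul_cancel, map_one, Equiv.Perm.one_apply,
            inv_inv] at h1
          have h2 : h⁻¹ * b * h ∈ P := by
            rcases hR with hR | hR
            · exact le_hubGroup ((le_iSup₂_of_le R hR le_rfl : apexGroup ρ n R ≤ K) h1)
            · exact apexGroup_le_hubGroup hR h1
          have h3 := mul_mem (mul_mem hh h2) (inv_mem hh)
          have e : h * (h⁻¹ * b * h) * h⁻¹ = b := by group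
          rwa [e] at h3
        · rw [hP, hubGroup, Subgroup.closure_le]
          rintro b (hb | ⟨Q, hQ, hb⟩)
          · refine (iSup₂_le fun Q hQ => ?_ : K ≤ _) hb
            exact le_iSup₂_of_le Q (hsub (Or.inl hQ)) le_rfl
          · exact (le_iSup₂_of_le Q (hsub (Or.inr hQ)) le_rfl : apexGroup ρ n Q ≤ _) hb
      · rintro _ ⟨h, hh, R, hR, rfl⟩ _ ⟨v, hv, rfl⟩
        refine apply_mem_spread hh ?_
        rcases hR with hR | hR
        · exact subset_spread (hW.subset_of_mem hR hv)
        · exact axis_subset_spread hR hv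
      · intro R hR x hxR y hyR hx hy
        refine hH.dist_le_of_mem_spread (fun h hh v hv hmem => hR ?_)
          (fun h hh Q hQ hQR => hR ⟨h, hh, Q, Or.inr hQ, hQR⟩) hxR hyR hx hy
        -- If an axis meets the translate of `C` by `h`, its translate by `h⁻¹` has its apex in `W`
        -- or is adjacent to `W`, so the axis belongs to `A'`.
        obtain ⟨R, rfl⟩ := (axesPerm ρ g h).surjective R
        rw [apply_mem_axesPerm] at hmem
        refine ⟨h, hh, R, ?_, rfl⟩
        by_cases hRW : R ∈ apicesIn ρ W
        · exact Or.inl hRW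
        · exact Or.inr ⟨⟨v, hmem, hv⟩, hRW⟩
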